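/- Let $(M,g)$ and $(N,h)$ be smooth finite-dimensional Riemannian manifolds without boundary, with Levi-Civita connections $\nabla$, let $\phi\colon M\to N$ be a smooth map, and let $\bar\nabla$ be the induced connection on the pull-back bundle $\phi^\ast TN$. Let $R^N(Y,Z)W=[\nabla_Y,\nabla_Z]W-\nabla_{[Y,Z]}W$ be the curvature tensor of $N$, $\bar\Delta=-\operatorname{Tr}_g(\bar\nabla\bar\nabla-\bar\nabla_\nabla)$ the rough Laplacian on $\phi^\ast TN$, $\tau(\phi)=\operatorname{Tr}_g\bar\nabla d\phi$ the tension field of $\phi$, and $$\tau_2(\phi)=-\bar\Delta\tau(\phi)-\operatorname{Tr}_g R^N(d\phi(\cdot),\tau(\phi))d\phi(\cdot)$$ its bitension field. Let $X$ be a smooth Killing vector field on $N$, that is, $\langle\nabla_YX,Z\rangle+\langle\nabla_ZX,Y\rangle=0$ for all tangent vectors $Y,Z$ of $N$ at the same point. Then $$J^2(\phi)=\langle\bar\nabla(X\circ\phi),\tau(\phi)\rangle^\sharp-\langle X\circ\phi,\bar\nabla\tau(\phi)\rangle^\sharp$$ is a smooth vector field on $M$, and $$\operatorname{div}J^2(\phi)=-\langle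 X\circ\phi,\tau_2(\phi)\rangle .$$ In particular, if $\phi$ is biharmonic, i.e. $\tau_2(\phi)=0$, then $J^2(\phi)$ is divergence-free. -/

import Mathlib

open scoped Manifold ContDiff Bundle

noncomputable section

namespace BiharmonicCurrent

section Intrinsic

/-! ### Levi-Civita connection, divergence and curvature of a Riemannian manifold

`M` is a manifold without boundary modelled on the finite-dimensional space `E`, with a Riemannian
metric on its tangent bundle. In Mathlib the tangent space at `q` is a copy of `E`, identified
through the preferred chart at `q`; the trivialization `trivializationAt E _ q` of the tangent
bundle is the one given by this chart, and it is the identity on the fibre over `q`. -/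

variable {E : Type*} [NormedAddCommGroup E] [NormedSpace ℝ E] [FiniteDimensional ℝ E]
  {M : Type*} [TopologicalSpace M] [ChartedSpace E M] [IsManifold 𝓘(ℝ, E) ∞ M]

instance instFiniteDimensionalTangentSpace (x : M) :
    FiniteDimensional ℝ (TangentSpace 𝓘(ℝ, E) x) :=
  inferInstanceAs (FiniteDimensional ℝ E)

variable [Bundle.RiemannianBundle (fun x : M => TangentSpace 𝓘(ℝ, E) x)]

instance instCompleteSpaceTangentSpace (x : M) :
    CompleteSpace (TangentSpace 𝓘(ℝ, E) x) :=
  FiniteDimensional.complete ℝ _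

/-- The metric read in the preferred chart at `q`: to a point `y` near `q` it associates the
bilinear form `(v, w) ↦ ⟨v, w⟩_y`, where `v, w : E` stand for the tangent vectors at `y` with
these coordinates. -/
def metricCoord (q y : M) : E →L[ℝ] E →L[ℝ] ℝ :=
  (innerSL ℝ (E := TangentSpace 𝓘(ℝ, E) y)).bilinearComp
    ((trivializationAt E (TangentSpace 𝓘(ℝ, E)) q).symmL ℝ y)
    ((trivializationAt E (TangentSpace 𝓘(ℝ, E)) q).symmL ℝ y)

/-- The first derivatives of the metric coefficients at `q`, in the preferred chart at `q`:
`metricDeriv q u v w = ∂_u g(v, w)`. -/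
def metricDeriv (q : M) : E →L[ℝ] E →L[ℝ] E →L[ℝ] ℝ :=
  mfderiv 𝓘(ℝ, E) 𝓘(ℝ, E →L[ℝ] E →L[ℝ] ℝ) (metricCoord (E := E) q) q

/-- The Christoffel symbols of the first kind at `q`, in the preferred chart at `q`:
`christoffelFirst q w u z = (∂_u g(w, z) + ∂_w g(u, z) - ∂_z g(w, u)) / 2`. -/
def christoffelFirst (q : M) (w : TangentSpace 𝓘(ℝ, E) q) :
    TangentSpace 𝓘(ℝ, E) q →L[ℝ] TangentSpace 𝓘(ℝ, E) q →L[ℝ] ℝ :=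
  (1 / 2 : ℝ) • ((metricDeriv (E := E) q).flip w + metricDeriv (E := E) q w
    - ((metricDeriv (E := E) q).flip w).flip)

/-- The Christoffel symbols of the Levi-Civita connection at `q`, in the preferred chart at `q`:
`christoffel q w u = Γ(u, w)`, i.e. `⟨Γ(u, w), z⟩ = christoffelFirst q w u z`. -/
def christoffel (q : M) (w : TangentSpace 𝓘(ℝ, E) q) :
    TangentSpace 𝓘(ℝ, E) q →L[ℝ] TangentSpace 𝓘(ℝ, E) q :=
  LinearMap.toContinuousLinearMap
    { toFun := fun u => (InnerProductSpace.toDual ℝ (TangentSpace 𝓘(ℝ, E) q)).symm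
        (christoffelFirst q w u)
      map_add' := by simp
      map_smul' := by simp }

/-- The Levi-Civita connection: `leviCivita Y x v = (∇_v Y)(x) = D_v Y + Γ(v, Y x)`, computed in the
preferred chart at `x`. -/
def leviCivita (Y : Π x : M, TangentSpace 𝓘(ℝ, E) x) (x : M) :
    TangentSpace 𝓘(ℝ, E) x →L[ℝ] TangentSpace 𝓘(ℝ, E) x :=
  ((trivializationAt E (TangentSpace 𝓘(ℝ, E)) x).symmL ℝ x).comp
      (mfderiv 𝓘(ℝ, E) 𝓘(ℝ, E)
        (fun y => (trivializationAt E (TangentSpace 𝓘(ℝ, E)) x ⟨y, Y y⟩).2) x)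
    + christoffel x (Y x)

/-- The divergence of a vector field: the trace of `v ↦ ∇_v Y`. -/
def divergence (Y : Π x : M, TangentSpace 𝓘(ℝ, E) x) (x : M) : ℝ :=
  LinearMap.trace ℝ (TangentSpace 𝓘(ℝ, E) x) (leviCivita Y x)

/-- The Riemannian curvature on vector fields,
`R(X, Y) Z = ∇_X ∇_Y Z - ∇_Y ∇_X Z - ∇_[X, Y] Z`. -/
def curvatureField (X Y Z : Π x : M, TangentSpace 𝓘(ℝ, E) x) (x : M) : TangentSpace 𝓘(ℝ, E) x :=
  leviCivita (fun y => leviCivita Z y (Y y)) x (X x)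
    - leviCivita (fun y => leviCivita Z y (X y)) x (Y x)
    - leviCivita Z x (VectorField.mlieBracket 𝓘(ℝ, E) X Y x)

/-- The Riemannian curvature tensor `R(u, v) w` on tangent vectors at `x`, through local
extensions of `u`, `v`, `w` to vector fields. -/
def curvature (x : M) (u v w : TangentSpace 𝓘(ℝ, E) x) : TangentSpace 𝓘(ℝ, E) x :=
  curvatureField (FiberBundle.extend E u) (FiberBundle.extend E v) (FiberBundle.extend E w) x

/-- The Lie derivative of the metric, `(L_X h)(u, w) = ⟨∇_u X, w⟩ + ⟨∇_w X, u⟩`. -/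
def lieDerivMetric (X : Π x : M, TangentSpace 𝓘(ℝ, E) x) (x : M) (u w : TangentSpace 𝓘(ℝ, E) x) :
    ℝ :=
  inner ℝ (leviCivita X x u) w + inner ℝ (leviCivita X x w) u

/-- Killing vector fields: smooth vector fields with `L_X h = 0`. -/
structure IsKilling (X : Π x : M, TangentSpace 𝓘(ℝ, E) x) : Prop where
  contMDiff : ContMDiff 𝓘(ℝ, E) 𝓘(ℝ, E).tangent ∞
    (fun x => (⟨x, X x⟩ : TangentBundle 𝓘(ℝ, E) M))
  lieDerivMetric_eq_zero : ∀ (x : M) (u w : TangentSpace 𝓘(ℝ, E) x), lieDerivMetric X x u w = 0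

/-- The musical isomorphism `♯`, applied pointwise to a one-form. -/
def sharp (α : Π x : M, TangentSpace 𝓘(ℝ, E) x →L[ℝ] ℝ) (x : M) : TangentSpace 𝓘(ℝ, E) x :=
  (InnerProductSpace.toDual ℝ (TangentSpace 𝓘(ℝ, E) x)).symm (α x)

end Intrinsic

section Along

/-! ### Maps between Riemannian manifolds -/

variable {E : Type*} [NormedAddCommGroup E] [NormedSpace ℝ E] [FiniteDimensional ℝ E]
  {M : Type*} [TopologicalSpace M] [ChartedSpace E M] [IsManifold 𝓘(ℝ, E) ∞ M]
  [Bundle.RiemannianBundle (fun x : M => TangentSpace 𝓘(ℝ, E) x)]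
  {F : Type*} [NormedAddCommGroup F] [NormedSpace ℝ F] [FiniteDimensional ℝ F]
  {N : Type*} [TopologicalSpace N] [ChartedSpace F N] [IsManifold 𝓘(ℝ, F) ∞ N]
  [Bundle.RiemannianBundle (fun y : N => TangentSpace 𝓘(ℝ, F) y)]

/-- The connection `∇̄` on the pull-back bundle `φ^* TN`, for sections `V` of this bundle (vector
fields along `φ`): `pullbackConn φ V x v = (∇̄_v V)(x) = D_v V + Γ(dφ(v), V x)`, computed in the
preferred chart at `φ x`, with the Christoffel symbols of `N`. -/
def pullbackConn (φ : M → N) (V : Π x : M, TangentSpace 𝓘(ℝ, F) (φ x)) (x : M) :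
    TangentSpace 𝓘(ℝ, E) x →L[ℝ] TangentSpace 𝓘(ℝ, F) (φ x) :=
  ((trivializationAt F (TangentSpace 𝓘(ℝ, F)) (φ x)).symmL ℝ (φ x)).comp
      (mfderiv 𝓘(ℝ, E) 𝓘(ℝ, F)
        (fun y => (trivializationAt F (TangentSpace 𝓘(ℝ, F)) (φ x) ⟨φ y, V y⟩).2) x)
    + (christoffel (φ x) (V x)).comp (mfderiv 𝓘(ℝ, E) 𝓘(ℝ, F) φ x)

/-- The covariant derivative of a one-form `A` on `M` with values in `φ^* TN`,
`(∇̄A)(u, v) = ∇̄_u (A(V)) - A(∇_u V)`, where `V` is a local extension of the tangent vector `v`. -/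
def pullbackConnOneForm (φ : M → N)
    (A : Π x : M, TangentSpace 𝓘(ℝ, E) x →L[ℝ] TangentSpace 𝓘(ℝ, F) (φ x))
    (x : M) (u v : TangentSpace 𝓘(ℝ, E) x) : TangentSpace 𝓘(ℝ, F) (φ x) :=
  pullbackConn φ (fun y => A y (FiberBundle.extend E v y)) x u
    - A x (leviCivita (FiberBundle.extend E v) x u)

/-- The trace with respect to the metric of `M` of a bilinear map on a tangent space: the sum of
`B(e_i, e_i)` over an orthonormal basis. -/
def metricTrace {W : Type*} [AddCommGroup W] (x : M)
    (B : TangentSpace 𝓘(ℝ, E) x → TangentSpace 𝓘(ℝ, E) x → W) : W :=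
  ∑ i, B (stdOrthonormalBasis ℝ (TangentSpace 𝓘(ℝ, E) x) i)
    (stdOrthonormalBasis ℝ (TangentSpace 𝓘(ℝ, E) x) i)

/-- The tension field `τ(φ) = Tr_g ∇̄dφ`. -/
def tension (φ : M → N) (x : M) : TangentSpace 𝓘(ℝ, F) (φ x) :=
  metricTrace x (pullbackConnOneForm φ (fun y => mfderiv 𝓘(ℝ, E) 𝓘(ℝ, F) φ y) x)

/-- The rough Laplacian on `φ^* TN`, `Δ̄V = - Tr_g (∇̄∇̄ - ∇̄_∇) V`. -/
def roughLaplacian (φ : M → N) (V : Π x : M, TangentSpace 𝓘(ℝ, F) (φ x)) (x : M) :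
    TangentSpace 𝓘(ℝ, F) (φ x) :=
  - metricTrace x (pullbackConnOneForm φ (pullbackConn (E := E) φ V) x)

/-- The bitension field `τ₂(φ) = - Δ̄τ(φ) - Tr_g R^N(dφ(·), τ(φ)) dφ(·)`. -/
def bitension (φ : M → N) (x : M) : TangentSpace 𝓘(ℝ, F) (φ x) :=
  - roughLaplacian (E := E) φ (tension (E := E) φ) x
    - metricTrace x (fun u v : TangentSpace 𝓘(ℝ, E) x =>
        curvature (φ x) (mfderiv 𝓘(ℝ, E) 𝓘(ℝ, F) φ x u) (tension (E := E) φ x)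
          (mfderiv 𝓘(ℝ, E) 𝓘(ℝ, F) φ x v))

variable (E F) in
/-- Biharmonic maps: smooth solutions of the biharmonic map equation `τ₂(φ) = 0`. -/
structure IsBiharmonic (φ : M → N) : Prop where
  contMDiff : ContMDiff 𝓘(ℝ, E) 𝓘(ℝ, F) ∞ φ
  bitension_eq_zero : ∀ x : M, bitension (E := E) (F := F) φ x = 0

/-- The vector field `J²(φ) = ⟨∇̄(X ∘ φ), τ(φ)⟩^♯ - ⟨X ∘ φ, ∇̄τ(φ)⟩^♯` on `M`. -/
def biharmonicCurrent (φ : M → N) (X : Π q : N, TangentSpace 𝓘(ℝ, F) q) (x : M) :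
    TangentSpace 𝓘(ℝ, E) x :=
  sharp (fun y => (innerSL ℝ (E := TangentSpace 𝓘(ℝ, F) (φ y)) (tension (E := E) φ y)).comp
      (pullbackConn (E := E) φ (fun z => X (φ z)) y)) x
    - sharp (fun y => (innerSL ℝ (E := TangentSpace 𝓘(ℝ, F) (φ y)) (X (φ y))).comp
      (pullbackConn (E := E) φ (tension (E := E) φ) y)) x

end Along

end BiharmonicCurrent

end

/-! The divergence is computed by differentiating `⟨J², V⟩` for a field `V` extending a tangent
vector `u`. The mixed terms `⟨∇̄_u(X ∘ φ), ∇̄_u τ⟩` cancel, so tracing gives `div J² = ⟨τ, Tr ∇̄²(X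
∘ φ)⟩ - ⟨X ∘ φ, Tr ∇̄²τ⟩`. By the chain rule `Tr ∇̄²(X ∘ φ) = ∇_τ X + ∑ ∇²X(dφ e_i, dφ e_i)`. The
Killing equation enters twice: `⟨∇_τ X, τ⟩ = 0`, and `⟨∇²X(u, u), t⟩ = ⟨X, R(u, t)u⟩`. What remains
is `-⟨X ∘ φ, τ₂⟩`. These steps are `inner_leviCivita_biharmonicCurrent`,
`pullbackConnOneForm_pullbackConn_comp` and `IsKilling.inner_secondDeriv_self`.

Most of the work is regularity. Connections and traces are defined at each point through that
point's own chart and orthonormal basis, so smooth dependence on the point is not visible. It is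
recovered by expanding in the coordinate fields `frame q u` of one fixed chart: the Koszul formula
(`koszul_frame`) expresses their covariant derivatives by the metric, `smoothAlongAt_sharp` inverts
the metric smoothly, and `metricTrace_eq_sum` replaces orthonormal bases by a frame and its metric
dual. -/

noncomputable section

namespace BiharmonicCurrent

open Filter Topology

set_option linter.unusedSectionVars false

/-! ### Coordinate vector fields of a fixed chart -/

section Frames

variable {E : Type*} [NormedAddCommGroup E] [NormedSpace ℝ E]
  {M : Type*} [TopologicalSpace M] [ChartedSpace E M] [IsManifold 𝓘(ℝ, E) ∞ M]
  {W : Type*} [NormedAddCommGroup W] [NormedSpace ℝ W]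

/-- The vector field with constant coordinates `u` in the preferred chart at `q`. -/
def frame (q : M) (u : E) (y : M) : TangentSpace 𝓘(ℝ, E) y :=
  (trivializationAt E (TangentSpace 𝓘(ℝ, E)) q).symmL ℝ y u

/-- The coordinates of a tangent vector at `y` in the preferred chart at `q`. -/
def coord (q y : M) : TangentSpace 𝓘(ℝ, E) y →L[ℝ] E :=
  (trivializationAt E (TangentSpace 𝓘(ℝ, E)) q).continuousLinearMapAt ℝ y

omit [NormedSpace ℝ E] [IsManifold 𝓘(ℝ, E) ∞ M] in
theorem eventually_mem_chart_source {q y : M} (hy : y ∈ (chartAt E q).source) :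
    ∀ᶠ z in 𝓝 y, z ∈ (chartAt E q).source :=
  (chartAt E q).open_source.mem_nhds hy

theorem coord_eq {q y : M} (hy : y ∈ (chartAt E q).source) (v : TangentSpace 𝓘(ℝ, E) y) :
    coord q y v = (trivializationAt E (TangentSpace 𝓘(ℝ, E)) q ⟨y, v⟩).2 := by
  rw [coord, Bundle.Trivialization.continuousLinearMapAt_apply,
    Bundle.Trivialization.coe_linearMapAt_of_mem _ hy]

@[simp]
theorem coord_frame {q y : M} (hy : y ∈ (chartAt E q).source) (u : E) :
    coord q y (frame q u y) = u :=
  (trivializationAt E (TangentSpace 𝓘(ℝ, E)) q).continuousLinearMapAt_symmL hy u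

@[simp]
theorem frame_coord {q y : M} (hy : y ∈ (chartAt E q).source) (v : TangentSpace 𝓘(ℝ, E) y) :
    frame q (coord q y v) y = v :=
  (trivializationAt E (TangentSpace 𝓘(ℝ, E)) q).symmL_continuousLinearMapAt hy v

theorem coord_self (q : M) (v : TangentSpace 𝓘(ℝ, E) q) : coord q q v = v := by
  rw [coord, TangentBundle.continuousLinearMapAt_trivializationAt_eq_core (mem_chart_source E q)]
  exact (tangentBundleCore 𝓘(ℝ, E) M).coordChange_self (achart E q) q (mem_chart_source E q) v

theorem frame_self (q : M) (u : E) : frame q u q = u := by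
  have h := coord_self q (frame q u q)
  rw [coord_frame (mem_chart_source E q)] at h
  exact h.symm

theorem frame_sum {ι : Type*} (s : Finset ι) (q : M) (c : ι → ℝ) (u : ι → E) (y : M) :
    frame q (∑ i ∈ s, c i • u i) y = ∑ i ∈ s, c i • frame q (u i) y := by
  simp [frame, map_sum, map_smul]

theorem coord_eq_mfderiv {q y : M} (hy : y ∈ (chartAt E q).source) (v : TangentSpace 𝓘(ℝ, E) y) :
    coord q y v = mvfderiv 𝓘(ℝ, E) (extChartAt 𝓘(ℝ, E) q) y v := by
  rw [coord, TangentBundle.continuousLinearMapAt_trivializationAt hy]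
  rfl

/-- `FiberBundle.extend` keeps coordinates constant in the trivialization at `q`, so near `q` the
extensions used in the definitions are coordinate fields. -/
theorem extend_eventuallyEq_frame {q : M} (u : TangentSpace 𝓘(ℝ, E) q) :
    ∀ᶠ y in 𝓝 q, FiberBundle.extend E u y = frame (E := E) q u y := by
  filter_upwards [eventually_mem_chart_source (mem_chart_source E q)] with y hy
  have h := coord_self q u
  rw [coord_eq (mem_chart_source E q)] at h
  rw [FiberBundle.extend, h]
  exact ((trivializationAt E (TangentSpace 𝓘(ℝ, E)) q).symmL_apply (R := ℝ) hy u).symm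

theorem contMDiffAt_frame {q y : M} (hy : y ∈ (chartAt E q).source) (u : E) :
    ContMDiffAt 𝓘(ℝ, E) 𝓘(ℝ, E).tangent ∞
      (fun z => (⟨z, frame q u z⟩ : TangentBundle 𝓘(ℝ, E) M)) y := by
  have h := (trivializationAt E (TangentSpace 𝓘(ℝ, E)) q).contMDiffAt_section_iff
    (IB := 𝓘(ℝ, E)) (n := ∞) (s := fun z => frame q u z) (x₀ := y) hy
  refine h.2 ((contMDiffAt_const (c := u)).congr_of_eventuallyEq ?_)
  filter_upwards [eventually_mem_chart_source hy] with z hz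
  rw [← coord_eq hz, coord_frame hz]

theorem frame_eq_fderiv {q y : M} (hy : y ∈ (chartAt E q).source) {f : M → W}
    (hf : MDifferentiableAt 𝓘(ℝ, E) 𝓘(ℝ, W) f y) (u : E) :
    mvfderiv 𝓘(ℝ, E) f y (frame q u y) =
      fderiv ℝ (f ∘ (extChartAt 𝓘(ℝ, E) q).symm) (extChartAt 𝓘(ℝ, E) q y) u := by
  have hs : y ∈ (extChartAt 𝓘(ℝ, E) q).source := by rwa [extChartAt_source]
  have h1 : MDifferentiableAt 𝓘(ℝ, E) 𝓘(ℝ, E) (extChartAt 𝓘(ℝ, E) q).symm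
      (extChartAt 𝓘(ℝ, E) q y) := by
    have := mdifferentiableWithinAt_extChartAt_symm (I := 𝓘(ℝ, E)) (x := q)
      ((extChartAt 𝓘(ℝ, E) q).map_source hs)
    rwa [modelWithCornersSelf_coe, Set.range_id, mdifferentiableWithinAt_univ] at this
  have h2 : (extChartAt 𝓘(ℝ, E) q).symm (extChartAt 𝓘(ℝ, E) q y) = y :=
    (extChartAt 𝓘(ℝ, E) q).left_inv hs
  have h3 := mfderiv_comp_of_eq (I := 𝓘(ℝ, E)) (I' := 𝓘(ℝ, E)) (I'' := 𝓘(ℝ, W)) hf h1 h2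
  rw [← mfderiv_eq_fderiv, h3, frame, TangentBundle.symmL_trivializationAt hy]
  simp only [modelWithCornersSelf_coe, Set.range_id, mfderivWithin_univ]
  rw [h2]
  rfl

/-- In the chart at `q` both sides are second partial derivatives of `f ∘ κ.symm`, which are
symmetric. The point `y` ranges over the whole chart domain. -/
theorem mvfderiv_frame_comm {q y : M} (hy : y ∈ (chartAt E q).source) {f : M → W}
    (hf : ContMDiffAt 𝓘(ℝ, E) 𝓘(ℝ, W) ∞ f y) (u t : E) :
    mvfderiv 𝓘(ℝ, E) (fun z => mvfderiv 𝓘(ℝ, E) f z (frame q t z)) y (frame q u y) =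
      mvfderiv 𝓘(ℝ, E) (fun z => mvfderiv 𝓘(ℝ, E) f z (frame q u z)) y (frame q t y) := by
  set κ := extChartAt 𝓘(ℝ, E) q with hκ
  have hs : y ∈ κ.source := by rwa [hκ, extChartAt_source]
  have hκy : κ.symm (κ y) = y := κ.left_inv hs
  have hsymm : ContMDiffAt 𝓘(ℝ, E) 𝓘(ℝ, E) ∞ κ.symm (κ y) :=
    (contMDiffOn_extChartAt_symm q).contMDiffAt
      ((isOpen_extChartAt_target q).mem_nhds (κ.map_source hs))
  have hg : ContDiffAt ℝ ∞ (f ∘ κ.symm) (κ y) :=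
    contMDiffAt_iff_contDiffAt.1 (ContMDiffAt.comp_of_eq hf hsymm hκy)
  have hκ' : ContMDiffAt 𝓘(ℝ, E) 𝓘(ℝ, E) ∞ κ y := contMDiffAt_extChartAt' hy
  have hfd : ∀ᶠ z in 𝓝 y, MDifferentiableAt 𝓘(ℝ, E) 𝓘(ℝ, W) f z :=
    (contMDiffAt_iff_contMDiffAt_nhds (n := 1) (by simp)).1 (hf.of_le (by simp)) |>.mono
      fun z hz => hz.mdifferentiableAt one_ne_zero
  have hD : ContDiffAt ℝ 1 (fderiv ℝ (f ∘ κ.symm)) (κ y) :=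
    hg.fderiv_right (m := 1) (by norm_cast)
  have key : ∀ v w : E,
      mvfderiv 𝓘(ℝ, E) (fun z => mvfderiv 𝓘(ℝ, E) f z (frame q v z)) y (frame q w y) =
        fderiv ℝ (fderiv ℝ (f ∘ κ.symm)) (κ y) w v := by
    intro v w
    have hDv : ContDiffAt ℝ 1 (fun e => fderiv ℝ (f ∘ κ.symm) e v) (κ y) :=
      hD.clm_apply contDiffAt_const
    have e1 : (fun z => mvfderiv 𝓘(ℝ, E) f z (frame q v z)) =ᶠ[𝓝 y]
        (fun z => fderiv ℝ (f ∘ κ.symm) (κ z) v) := by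
      filter_upwards [hfd, eventually_mem_chart_source hy] with z hz hz'
      exact frame_eq_fderiv hz' hz v
    have e2 : ContMDiffAt 𝓘(ℝ, E) 𝓘(ℝ, W) 1 (fun z => fderiv ℝ (f ∘ κ.symm) (κ z) v) y :=
      ContMDiffAt.comp y hDv.contMDiffAt (hκ'.of_le (by simp))
    rw [mvfderiv, e1.mfderiv_eq]
    change mvfderiv 𝓘(ℝ, E) (fun z => fderiv ℝ (f ∘ κ.symm) (κ z) v) y (frame q w y) = _
    rw [frame_eq_fderiv hy (e2.mdifferentiableAt one_ne_zero) w]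
    have e3 : ((fun z => fderiv ℝ (f ∘ κ.symm) (κ z) v) ∘ κ.symm) =ᶠ[𝓝 (κ y)]
        (fun e => fderiv ℝ (f ∘ κ.symm) e v) := by
      filter_upwards [(isOpen_extChartAt_target q).mem_nhds (κ.map_source hs)] with e he
      simp only [Function.comp_apply]
      rw [κ.right_inv he]
    rw [e3.fderiv_eq, fderiv_clm_apply (hD.differentiableAt one_ne_zero)
      (differentiableAt_const v)]
    simp
  rw [key, key]
  exact (hg.isSymmSndFDerivAt (by simpa using WithTop.coe_le_coe.2 (le_top (a := (2 : ℕ∞))))).eq u t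

/-- Pulled back to the model space, coordinate fields are constant, and constant fields commute. -/
theorem mlieBracket_frame (q : M) (u t : E) :
    VectorField.mlieBracket 𝓘(ℝ, E) (frame q u) (frame q t) q = 0 := by
  have h : ∀ v : E, VectorField.mpullbackWithin 𝓘(ℝ, E) 𝓘(ℝ, E) (extChartAt 𝓘(ℝ, E) q).symm
      (frame q v) (Set.range 𝓘(ℝ, E)) =ᶠ[𝓝 (extChartAt 𝓘(ℝ, E) q q)] fun _ => v := by
    intro v
    filter_upwards [(isOpen_extChartAt_target (I := 𝓘(ℝ, E)) q).mem_nhds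
      (mem_extChartAt_target q)] with e he
    have hs : (extChartAt 𝓘(ℝ, E) q).symm e ∈ (chartAt E q).source := by
      rw [← extChartAt_source 𝓘(ℝ, E)]
      exact (extChartAt 𝓘(ℝ, E) q).map_target he
    rw [VectorField.mpullbackWithin_apply, frame, TangentBundle.symmL_trivializationAt hs,
      (extChartAt 𝓘(ℝ, E) q).right_inv he]
    exact (isInvertible_mfderivWithin_extChartAt_symm he).inverse_apply_self v
  have h0 : VectorField.lieBracketWithin ℝ
      (VectorField.mpullbackWithin 𝓘(ℝ, E) 𝓘(ℝ, E) (extChartAt 𝓘(ℝ, E) q).symm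
        (frame q u) (Set.range 𝓘(ℝ, E)))
      (VectorField.mpullbackWithin 𝓘(ℝ, E) 𝓘(ℝ, E) (extChartAt 𝓘(ℝ, E) q).symm
        (frame q t) (Set.range 𝓘(ℝ, E)))
      ((extChartAt 𝓘(ℝ, E) q).symm ⁻¹' Set.univ ∩ Set.range 𝓘(ℝ, E)) (extChartAt 𝓘(ℝ, E) q q)
      = 0 := by
    refine (Filter.EventuallyEq.lieBracketWithin_vectorField_eq_nhds (h u) (h t)).trans ?_
    simp [VectorField.lieBracketWithin]
  rw [VectorField.mlieBracket, VectorField.mlieBracketWithin_apply]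
  exact (congrArg _ h0).trans (map_zero _)

theorem mlieBracket_extend {q : M} (u t : TangentSpace 𝓘(ℝ, E) q) :
    VectorField.mlieBracket 𝓘(ℝ, E) (FiberBundle.extend E u) (FiberBundle.extend E t) q = 0 := by
  have h := Filter.EventuallyEq.mlieBracket_vectorField_eq (I := 𝓘(ℝ, E))
    (extend_eventuallyEq_frame u) (extend_eventuallyEq_frame t)
  rw [h]
  exact mlieBracket_frame (E := E) q u t

end Frames

/-! ### Smooth vector fields along a map -/

section SmoothAlong

variable {E : Type*} [NormedAddCommGroup E] [NormedSpace ℝ E]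
  {M : Type*} [TopologicalSpace M] [ChartedSpace E M] [IsManifold 𝓘(ℝ, E) ∞ M]
  {F : Type*} [NormedAddCommGroup F] [NormedSpace ℝ F]
  {N : Type*} [TopologicalSpace N] [ChartedSpace F N] [IsManifold 𝓘(ℝ, F) ∞ N]
  {W : Type*} [NormedAddCommGroup W] [NormedSpace ℝ W]

variable (E F) in
/-- Smoothness at `x` of the vector field `V` along the map `φ`. -/
def SmoothAlongAt (φ : M → N) (V : Π y : M, TangentSpace 𝓘(ℝ, F) (φ y)) (x : M) : Prop :=
  ContMDiffAt 𝓘(ℝ, E) 𝓘(ℝ, F).tangent ∞ (fun y => (⟨φ y, V y⟩ : TangentBundle 𝓘(ℝ, F) N)) x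

namespace SmoothAlongAt

variable {φ : M → N} {V V' : Π y : M, TangentSpace 𝓘(ℝ, F) (φ y)} {x : M}

/-- Smoothness may be tested in any chart around `φ x`, which allows one chart to serve all nearby
points. -/
theorem iff_coord {q : N} (hq : φ x ∈ (chartAt F q).source) :
    SmoothAlongAt E F φ V x ↔ ContMDiffAt 𝓘(ℝ, E) 𝓘(ℝ, F) ∞ φ x ∧
      ContMDiffAt 𝓘(ℝ, E) 𝓘(ℝ, F) ∞ (fun y => coord q (φ y) (V y)) x := by
  rw [SmoothAlongAt, (trivializationAt F (TangentSpace 𝓘(ℝ, F)) q).contMDiffAt_iff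
    (IB := 𝓘(ℝ, F)) (n := ∞) (by simpa using hq)]
  refine and_congr_right fun h => ?_
  refine Filter.EventuallyEq.contMDiffAt_iff ?_
  filter_upwards [h.continuousAt.eventually (eventually_mem_chart_source hq)] with y hy
  exact (coord_eq hy _).symm

theorem base (h : SmoothAlongAt E F φ V x) : ContMDiffAt 𝓘(ℝ, E) 𝓘(ℝ, F) ∞ φ x :=
  ((iff_coord (mem_chart_source F (φ x))).1 h).1

theorem coord {q : N} (h : SmoothAlongAt E F φ V x) (hq : φ x ∈ (chartAt F q).source) :
    ContMDiffAt 𝓘(ℝ, E) 𝓘(ℝ, F) ∞ (fun y => coord q (φ y) (V y)) x :=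
  ((iff_coord hq).1 h).2

theorem congr (h : SmoothAlongAt E F φ V x) (hV : ∀ᶠ y in 𝓝 x, V' y = V y) :
    SmoothAlongAt E F φ V' x :=
  ContMDiffAt.congr_of_eventuallyEq h (hV.mono fun y hy => by simp only [hy])

theorem eventually_mem_source (h : SmoothAlongAt E F φ V x) {q : N}
    (hq : φ x ∈ (chartAt F q).source) : ∀ᶠ y in 𝓝 x, φ y ∈ (chartAt F q).source :=
  h.base.continuousAt.eventually (eventually_mem_chart_source hq)

theorem add (h : SmoothAlongAt E F φ V x) (h' : SmoothAlongAt E F φ V' x) :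
    SmoothAlongAt E F φ (fun y => V y + V' y) x := by
  refine (iff_coord (mem_chart_source F (φ x))).2 ⟨h.base, ?_⟩
  simp only [map_add]
  exact (h.coord (mem_chart_source F (φ x))).add (h'.coord (mem_chart_source F (φ x)))

theorem smul {f : M → ℝ} (hf : ContMDiffAt 𝓘(ℝ, E) 𝓘(ℝ, ℝ) ∞ f x)
    (h : SmoothAlongAt E F φ V x) : SmoothAlongAt E F φ (fun y => f y • V y) x := by
  refine (iff_coord (mem_chart_source F (φ x))).2 ⟨h.base, ?_⟩
  simp only [map_smul]
  exact hf.smul (h.coord (mem_chart_source F (φ x)))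

theorem sub (h : SmoothAlongAt E F φ V x) (h' : SmoothAlongAt E F φ V' x) :
    SmoothAlongAt E F φ (fun y => V y - V' y) x := by
  refine (iff_coord (mem_chart_source F (φ x))).2 ⟨h.base, ?_⟩
  simp only [map_sub]
  exact (h.coord (mem_chart_source F (φ x))).sub (h'.coord (mem_chart_source F (φ x)))

theorem zero (h : ContMDiffAt 𝓘(ℝ, E) 𝓘(ℝ, F) ∞ φ x) :
    SmoothAlongAt E F φ (fun _ => 0) x := by
  refine (iff_coord (mem_chart_source F (φ x))).2 ⟨h, ?_⟩
  simp only [map_zero]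
  exact contMDiffAt_const

theorem sum {ι : Type*} {s : Finset ι} {V : ι → Π y : M, TangentSpace 𝓘(ℝ, F) (φ y)}
    (hφ : ContMDiffAt 𝓘(ℝ, E) 𝓘(ℝ, F) ∞ φ x)
    (h : ∀ i ∈ s, SmoothAlongAt E F φ (V i) x) :
    SmoothAlongAt E F φ (fun y => ∑ i ∈ s, V i y) x := by
  classical
  induction s using Finset.induction_on with
  | empty => simpa using zero hφ
  | insert i s hi ih =>
    simp only [Finset.sum_insert hi]
    exact (h i (Finset.mem_insert_self i s)).add
      (ih fun j hj => h j (Finset.mem_insert_of_mem hj))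

theorem comp {Y : Π p : N, TangentSpace 𝓘(ℝ, F) p} (hY : SmoothAlongAt F F (fun p => p) Y (φ x))
    (hφ : ContMDiffAt 𝓘(ℝ, E) 𝓘(ℝ, F) ∞ φ x) :
    SmoothAlongAt E F φ (fun y => Y (φ y)) x :=
  ContMDiffAt.comp (I' := 𝓘(ℝ, F)) x hY hφ

theorem frame {q : N} (hφ : ContMDiffAt 𝓘(ℝ, E) 𝓘(ℝ, F) ∞ φ x)
    (hq : φ x ∈ (chartAt F q).source) (u : F) :
    SmoothAlongAt E F φ (fun y => frame q u (φ y)) x :=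
  comp (contMDiffAt_frame hq u) hφ

theorem mfderiv {U : Π y : M, TangentSpace 𝓘(ℝ, E) y} (hφ : ContMDiffAt 𝓘(ℝ, E) 𝓘(ℝ, F) ∞ φ x)
    (hU : SmoothAlongAt E E (fun y => y) U x) :
    SmoothAlongAt E F φ (fun y => mfderiv 𝓘(ℝ, E) 𝓘(ℝ, F) φ y (U y)) x :=
  ContMDiffAt.clm_apply_of_inCoordinates (b₁ := fun y : M => y) (b₂ := φ)
    (ContMDiffAt.mfderiv_const (m := ∞) hφ (by simp)) hU hφ

end SmoothAlongAt

theorem eventually_smoothAlongAt_extend {x : M} (u : TangentSpace 𝓘(ℝ, E) x) :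
    ∀ᶠ y in 𝓝 x, SmoothAlongAt E E (fun y => y) (FiberBundle.extend E u) y := by
  filter_upwards [(extend_eventuallyEq_frame u).eventually_nhds,
    eventually_mem_chart_source (mem_chart_source E x)] with y hy hys
  exact SmoothAlongAt.congr (contMDiffAt_frame hys u) hy

theorem contMDiffAt_mvfderiv {f : M → W} {x : M} {U : Π y : M, TangentSpace 𝓘(ℝ, E) y}
    (hf : ContMDiffAt 𝓘(ℝ, E) 𝓘(ℝ, W) ∞ f x) (hU : SmoothAlongAt E E (fun y => y) U x) :
    ContMDiffAt 𝓘(ℝ, E) 𝓘(ℝ, W) ∞ (fun y => mvfderiv 𝓘(ℝ, E) f y (U y)) x :=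
  ContMDiffAt.comp x (contMDiff_snd_tangentBundle_modelSpace W 𝓘(ℝ, W)).contMDiffAt
    (SmoothAlongAt.mfderiv hf hU)

/-- The components of a tangent vector at `y` in the preferred chart at `q`. -/
def component [FiniteDimensional ℝ F] (q y : N) (i : Fin (Module.finrank ℝ F)) :
    TangentSpace 𝓘(ℝ, F) y →L[ℝ] ℝ :=
  (LinearMap.toContinuousLinearMap ((Module.finBasis ℝ F).coord i)).comp (coord q y)

variable [FiniteDimensional ℝ F]

theorem sum_component_smul_frame {q y : N} (hy : y ∈ (chartAt F q).source)
    (v : TangentSpace 𝓘(ℝ, F) y) :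
    ∑ i, component q y i v • frame q (Module.finBasis ℝ F i) y = v := by
  rw [← frame_sum]
  conv_rhs => rw [← frame_coord hy v]
  congr 1
  exact (Module.finBasis ℝ F).sum_repr (coord q y v)

theorem SmoothAlongAt.component {φ : M → N} {V : Π y : M, TangentSpace 𝓘(ℝ, F) (φ y)} {x : M}
    {q : N} (h : SmoothAlongAt E F φ V x) (hq : φ x ∈ (chartAt F q).source)
    (i : Fin (Module.finrank ℝ F)) :
    ContMDiffAt 𝓘(ℝ, E) 𝓘(ℝ, ℝ) ∞ (fun y => component q (φ y) i (V y)) x :=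
  ContMDiffAt.comp x (ContinuousLinearMap.contMDiff
    (LinearMap.toContinuousLinearMap ((Module.finBasis ℝ F).coord i))).contMDiffAt (h.coord hq)

end SmoothAlong

/-! ### Metric coefficients and Christoffel symbols -/

section Metric

variable {E : Type*} [NormedAddCommGroup E] [NormedSpace ℝ E]
  {M : Type*} [TopologicalSpace M] [ChartedSpace E M]
  {F : Type*} [NormedAddCommGroup F] [NormedSpace ℝ F] [FiniteDimensional ℝ F]
  {W : Type*} [NormedAddCommGroup W] [NormedSpace ℝ W]

/-- In finite dimension `A` is the finite sum of `c i ⊗ A (b i)` over a basis `b` with dual basis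
`c`, so its values on basis vectors control it. -/
theorem contMDiffAt_clm_of_apply {A : M → F →L[ℝ] W} {x : M}
    (h : ∀ u, ContMDiffAt 𝓘(ℝ, E) 𝓘(ℝ, W) ∞ (fun y => A y u) x) :
    ContMDiffAt 𝓘(ℝ, E) 𝓘(ℝ, F →L[ℝ] W) ∞ A x := by
  let b := Module.finBasis ℝ F
  let c : Fin (Module.finrank ℝ F) → F →L[ℝ] ℝ := fun i =>
    LinearMap.toContinuousLinearMap (b.coord i)
  have hA : A = fun y => ∑ i, (ContinuousLinearMap.smulRightL ℝ F W (c i)) (A y (b i)) := by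
    funext y
    ext u
    conv_lhs => rw [← b.sum_repr u, map_sum]
    simp [c]
  rw [hA]
  refine ContMDiffAt.sum fun i _ => ?_
  exact ContMDiffAt.comp x (ContinuousLinearMap.contMDiff
    (ContinuousLinearMap.smulRightL ℝ F W (c i))).contMDiffAt (h (b i))

omit [FiniteDimensional ℝ F] in
theorem mvfderiv_clm_apply {A : M → F →L[ℝ] W} {c : M → F} {x : M}
    (hA : MDifferentiableAt 𝓘(ℝ, E) 𝓘(ℝ, F →L[ℝ] W) A x)
    (hc : MDifferentiableAt 𝓘(ℝ, E) 𝓘(ℝ, F) c x) (v : TangentSpace 𝓘(ℝ, E) x) :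
    mvfderiv 𝓘(ℝ, E) (fun y => A y (c y)) x v =
      mvfderiv 𝓘(ℝ, E) A x v (c x) + A x (mvfderiv 𝓘(ℝ, E) c x v) := by
  -- The derivatives are retyped as maps between the model spaces, so that `flip` and `comp` do not
  -- meet tangent spaces of vector spaces.
  let A' : E →L[ℝ] F →L[ℝ] W := mvfderiv 𝓘(ℝ, E) A x
  let c' : E →L[ℝ] F := mvfderiv 𝓘(ℝ, E) c x
  let D : E →L[ℝ] W := (A x).comp c' + A'.flip (c x)
  have h : HasMFDerivAt 𝓘(ℝ, E) 𝓘(ℝ, W) (fun y => A y (c y)) x D := by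
    refine ⟨hA.continuousAt.clm_apply hc.continuousAt, ?_⟩
    convert! hA.hasMFDerivAt.2.clm_apply hc.hasMFDerivAt.2 using 1
    simp only [writtenInExtChartAt, extChartAt, mfld_simps, Function.comp_apply,
      (chartAt E x).left_inv (mem_chart_source E x)]
    rfl
  rw [mvfderiv, h.mfderiv]
  exact add_comm _ _

omit [FiniteDimensional ℝ F] in
theorem mvfderiv_clm_comp (L : F →L[ℝ] W) {c : M → F} {x : M}
    (hc : MDifferentiableAt 𝓘(ℝ, E) 𝓘(ℝ, F) c x) (v : TangentSpace 𝓘(ℝ, E) x) :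
    mvfderiv 𝓘(ℝ, E) (fun y => L (c y)) x v = L (mvfderiv 𝓘(ℝ, E) c x v) := by
  rw [mvfderiv_clm_apply mdifferentiableAt_const hc, mvfderiv_const]
  simp

omit [FiniteDimensional ℝ F] in
theorem mvfderiv_comp_map {N : Type*} [TopologicalSpace N] [ChartedSpace F N] {φ : M → N}
    {f : N → W} {x : M} (hf : MDifferentiableAt 𝓘(ℝ, F) 𝓘(ℝ, W) f (φ x))
    (hφ : MDifferentiableAt 𝓘(ℝ, E) 𝓘(ℝ, F) φ x) (v : TangentSpace 𝓘(ℝ, E) x) :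
    mvfderiv 𝓘(ℝ, E) (fun y => f (φ y)) x v =
      mvfderiv 𝓘(ℝ, F) f (φ x) (mfderiv 𝓘(ℝ, E) 𝓘(ℝ, F) φ x v) :=
  congrArg (fun T => T v) (mfderiv_comp x hf hφ)

variable {N : Type*} [TopologicalSpace N] [ChartedSpace F N] [IsManifold 𝓘(ℝ, F) ∞ N]
  [Bundle.RiemannianBundle (fun y : N => TangentSpace 𝓘(ℝ, F) y)]

theorem metricCoord_apply (q y : N) (v w : F) :
    metricCoord q y v w = inner ℝ (frame q v y) (frame q w y) := rfl

theorem metricCoord_coord {q y : N} (hy : y ∈ (chartAt F q).source)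
    (v w : TangentSpace 𝓘(ℝ, F) y) :
    metricCoord q y (coord q y v) (coord q y w) = inner ℝ v w := by
  rw [metricCoord_apply, frame_coord hy, frame_coord hy]

theorem metricCoord_self (q : N) (a b : TangentSpace 𝓘(ℝ, F) q) :
    metricCoord (E := F) q q a b = inner ℝ a b := by
  have h := metricCoord_coord (mem_chart_source F q) a b
  rwa [coord_self, coord_self] at h

theorem inner_christoffel (q : N) (w u z : TangentSpace 𝓘(ℝ, F) q) :
    inner ℝ (christoffel q w u) z = christoffelFirst q w u z :=
  InnerProductSpace.toDual_symm_apply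

/-- `metricDeriv` as a function of three tangent vectors. -/
def metricDerivAt (q : N) (u v w : TangentSpace 𝓘(ℝ, F) q) : ℝ :=
  metricDeriv (E := F) q u v w

theorem christoffelFirst_apply (q : N) (w u z : TangentSpace 𝓘(ℝ, F) q) :
    christoffelFirst q w u z =
      (1 / 2 : ℝ) * (metricDerivAt q u w z + metricDerivAt q w u z - metricDerivAt q z w u) := rfl

theorem metricDerivAt_add_left (q : N) (u u' v w : TangentSpace 𝓘(ℝ, F) q) :
    metricDerivAt q (u + u') v w = metricDerivAt q u v w + metricDerivAt q u' v w :=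
  congrArg (fun T : F →L[ℝ] F →L[ℝ] ℝ => T v w) ((metricDeriv (E := F) q).map_add u u')

theorem metricDerivAt_add_mid (q : N) (u v v' w : TangentSpace 𝓘(ℝ, F) q) :
    metricDerivAt q u (v + v') w = metricDerivAt q u v w + metricDerivAt q u v' w :=
  congrArg (fun T : F →L[ℝ] ℝ => T w) (map_add (metricDeriv (E := F) q u) v v')

theorem metricDerivAt_smul_left (q : N) (c : ℝ) (u v w : TangentSpace 𝓘(ℝ, F) q) :
    metricDerivAt q (c • u) v w = c * metricDerivAt q u v w :=
  congrArg (fun T : F →L[ℝ] F →L[ℝ] ℝ => T v w) ((metricDeriv (E := F) q).map_smul c u)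

theorem metricDerivAt_smul_mid (q : N) (c : ℝ) (u v w : TangentSpace 𝓘(ℝ, F) q) :
    metricDerivAt q u (c • v) w = c * metricDerivAt q u v w :=
  congrArg (fun T : F →L[ℝ] ℝ => T w) (map_smul (metricDeriv (E := F) q u) c v)

theorem christoffel_add (q : N) (w w' u : TangentSpace 𝓘(ℝ, F) q) :
    christoffel q (w + w') u = christoffel q w u + christoffel q w' u := by
  refine ext_inner_right ℝ fun z => ?_
  rw [inner_add_left, inner_christoffel, inner_christoffel, inner_christoffel,
    christoffelFirst_apply, christoffelFirst_apply, christoffelFirst_apply,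
    metricDerivAt_add_left, metricDerivAt_add_mid, metricDerivAt_add_mid]
  ring

theorem christoffel_smul (q : N) (c : ℝ) (w u : TangentSpace 𝓘(ℝ, F) q) :
    christoffel q (c • w) u = c • christoffel q w u := by
  refine ext_inner_right ℝ fun z => ?_
  rw [real_inner_smul_left, inner_christoffel, inner_christoffel,
    christoffelFirst_apply, christoffelFirst_apply,
    metricDerivAt_smul_left, metricDerivAt_smul_mid, metricDerivAt_smul_mid]
  ring

variable [IsContMDiffRiemannianBundle 𝓘(ℝ, F) ∞ F (fun y : N => TangentSpace 𝓘(ℝ, F) y)]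

theorem contMDiffAt_inner_frame {q y : N} (hy : y ∈ (chartAt F q).source) (v w : F) :
    ContMDiffAt 𝓘(ℝ, F) 𝓘(ℝ, ℝ) ∞ (fun z => inner ℝ (frame q v z) (frame q w z)) y :=
  ContMDiffAt.inner_bundle (contMDiffAt_frame hy v) (contMDiffAt_frame hy w)

theorem contMDiffAt_metricCoord {q y : N} (hy : y ∈ (chartAt F q).source) :
    ContMDiffAt 𝓘(ℝ, F) 𝓘(ℝ, F →L[ℝ] F →L[ℝ] ℝ) ∞ (metricCoord (E := F) q) y :=
  contMDiffAt_clm_of_apply fun v => contMDiffAt_clm_of_apply fun w =>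
    contMDiffAt_inner_frame hy v w

set_option synthInstance.maxHeartbeats 200000 in
theorem metricDerivAt_apply (q : N) (u v w : TangentSpace 𝓘(ℝ, F) q) :
    metricDerivAt q u v w = mvfderiv 𝓘(ℝ, F)
      (fun y => (inner ℝ (frame (E := F) q v y) (frame (E := F) q w y) : ℝ)) q u := by
  have h : MDifferentiableAt 𝓘(ℝ, F) 𝓘(ℝ, F →L[ℝ] F →L[ℝ] ℝ) (metricCoord (E := F) q) q :=
    (contMDiffAt_metricCoord (mem_chart_source F q)).mdifferentiableAt (by simp)
  let L : (F →L[ℝ] F →L[ℝ] ℝ) →L[ℝ] ℝ :=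
    (ContinuousLinearMap.apply ℝ ℝ w).comp (ContinuousLinearMap.apply ℝ (F →L[ℝ] ℝ) v)
  exact (mvfderiv_clm_comp L h u).symm

theorem metricDerivAt_symm (q : N) (u v w : TangentSpace 𝓘(ℝ, F) q) :
    metricDerivAt q u v w = metricDerivAt q u w v := by
  rw [metricDerivAt_apply, metricDerivAt_apply]
  congr 2
  funext y
  exact real_inner_comm _ _

theorem christoffel_symm (q : N) (w u : TangentSpace 𝓘(ℝ, F) q) :
    christoffel q w u = christoffel q u w := by
  refine ext_inner_right ℝ fun z => ?_
  rw [inner_christoffel, inner_christoffel, christoffelFirst_apply, christoffelFirst_apply,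
    metricDerivAt_symm q z w u, add_comm (metricDerivAt q u w z)]

/-- Metric compatibility in coordinates: in the sum of the two symbols of the first kind, `∂_w g(u,
z)` and `∂_z g(u, w)` each occur with both signs. -/
theorem christoffel_metric (q : N) (u w z : TangentSpace 𝓘(ℝ, F) q) :
    inner ℝ (christoffel q w u) z + inner ℝ w (christoffel q z u) = metricDerivAt q u w z := by
  rw [real_inner_comm _ w, inner_christoffel, inner_christoffel,
    christoffelFirst_apply, christoffelFirst_apply, metricDerivAt_symm q u z w,
    metricDerivAt_symm q z w u, metricDerivAt_symm q w z u]
  ring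

end Metric

/-! ### Algebraic rules for the pull-back connection -/

section PullbackConn

variable {E : Type*} [NormedAddCommGroup E] [NormedSpace ℝ E]
  {M : Type*} [TopologicalSpace M] [ChartedSpace E M] [IsManifold 𝓘(ℝ, E) ∞ M]
  {F : Type*} [NormedAddCommGroup F] [NormedSpace ℝ F] [FiniteDimensional ℝ F]
  {N : Type*} [TopologicalSpace N] [ChartedSpace F N] [IsManifold 𝓘(ℝ, F) ∞ N]
  [Bundle.RiemannianBundle (fun y : N => TangentSpace 𝓘(ℝ, F) y)]
  {φ : M → N} {V V' : Π y : M, TangentSpace 𝓘(ℝ, F) (φ y)} {x : M}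

/-- The Levi-Civita connection is the pull-back connection of the identity, so rules proved along a
map apply to it too. -/
theorem pullbackConn_id (Y : Π p : N, TangentSpace 𝓘(ℝ, F) p) (p : N) :
    pullbackConn (E := F) (fun p => p) Y p = leviCivita Y p := by
  rw [pullbackConn, leviCivita]
  congr 1
  have : mfderiv 𝓘(ℝ, F) 𝓘(ℝ, F) (fun p : N => p) p = ContinuousLinearMap.id ℝ _ := mfderiv_id
  rw [this]
  rfl

/-- The derivative of the coordinates of the vector field `V` along `φ`, in the preferred chart at
`φ x`. -/
def coordDeriv (φ : M → N) (V : Π y : M, TangentSpace 𝓘(ℝ, F) (φ y)) (x : M) :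
    TangentSpace 𝓘(ℝ, E) x →L[ℝ] TangentSpace 𝓘(ℝ, F) (φ x) :=
  mvfderiv 𝓘(ℝ, E) (fun y => coord (φ x) (φ y) (V y)) x

theorem pullbackConn_apply (h : ContMDiffAt 𝓘(ℝ, E) 𝓘(ℝ, F) ∞ φ x)
    (v : TangentSpace 𝓘(ℝ, E) x) :
    pullbackConn φ V x v =
      coordDeriv φ V x v + christoffel (φ x) (V x) (mfderiv 𝓘(ℝ, E) 𝓘(ℝ, F) φ x v) := by
  have e : (fun y => coord (φ x) (φ y) (V y)) =ᶠ[𝓝 x]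
      fun y => (trivializationAt F (TangentSpace 𝓘(ℝ, F)) (φ x) ⟨φ y, V y⟩).2 := by
    filter_upwards [h.continuousAt.eventually
      (eventually_mem_chart_source (mem_chart_source F (φ x)))] with y hy
    exact coord_eq hy _
  have e' : coordDeriv φ V x v = frame (φ x) (mvfderiv 𝓘(ℝ, E) (fun y =>
      (trivializationAt F (TangentSpace 𝓘(ℝ, F)) (φ x) ⟨φ y, V y⟩).2) x v) (φ x) := by
    rw [frame_self, mvfderiv, ← e.mfderiv_eq]
    rfl
  rw [e']
  rfl

theorem pullbackConn_congr (hV : ∀ᶠ y in 𝓝 x, V y = V' y) :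
    pullbackConn (E := E) φ V x = pullbackConn φ V' x := by
  have e : (fun y => (trivializationAt F (TangentSpace 𝓘(ℝ, F)) (φ x) ⟨φ y, V y⟩).2) =ᶠ[𝓝 x]
      fun y => (trivializationAt F (TangentSpace 𝓘(ℝ, F)) (φ x) ⟨φ y, V' y⟩).2 :=
    hV.mono fun y hy => by simp only [hy]
  rw [pullbackConn, pullbackConn, e.mfderiv_eq, hV.self_of_nhds]

theorem pullbackConn_add (hV : SmoothAlongAt E F φ V x) (hV' : SmoothAlongAt E F φ V' x)
    (v : TangentSpace 𝓘(ℝ, E) x) :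
    pullbackConn φ (fun y => V y + V' y) x v = pullbackConn φ V x v + pullbackConn φ V' x v := by
  have h : coordDeriv φ (fun y => V y + V' y) x v = coordDeriv φ V x v + coordDeriv φ V' x v := by
    have := mvfderiv_fun_add
      ((hV.coord (mem_chart_source F (φ x))).mdifferentiableAt (by simp))
      ((hV'.coord (mem_chart_source F (φ x))).mdifferentiableAt (by simp))
    simp only [coordDeriv, map_add]
    exact congrArg (fun T => T v) this
  rw [pullbackConn_apply hV.base, pullbackConn_apply hV.base, pullbackConn_apply hV.base, h,
    christoffel_add]
  abel

theorem pullbackConn_smul {f : M → ℝ} (hf : ContMDiffAt 𝓘(ℝ, E) 𝓘(ℝ, ℝ) ∞ f x)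
    (hV : SmoothAlongAt E F φ V x) (v : TangentSpace 𝓘(ℝ, E) x) :
    pullbackConn φ (fun y => f y • V y) x v =
      mvfderiv 𝓘(ℝ, E) f x v • V x + f x • pullbackConn φ V x v := by
  have h : coordDeriv φ (fun y => f y • V y) x v =
      f x • coordDeriv φ V x v + mvfderiv 𝓘(ℝ, E) f x v • V x := by
    have := mvfderiv_fun_smul (hf.mdifferentiableAt (by simp))
      ((hV.coord (mem_chart_source F (φ x))).mdifferentiableAt (by simp))
    simp only [coordDeriv, map_smul]
    rw [coord_self] at this
    exact congrArg (fun T => T v) this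
  rw [pullbackConn_apply hV.base, pullbackConn_apply hV.base, h, christoffel_smul, smul_add]
  abel

theorem pullbackConn_zero (hφ : ContMDiffAt 𝓘(ℝ, E) 𝓘(ℝ, F) ∞ φ x)
    (v : TangentSpace 𝓘(ℝ, E) x) :
    pullbackConn φ (fun y => (0 : TangentSpace 𝓘(ℝ, F) (φ y))) x v = 0 := by
  have := pullbackConn_add (SmoothAlongAt.zero hφ) (SmoothAlongAt.zero hφ) v
  simpa using this

theorem pullbackConn_sum {ι : Type*} (s : Finset ι)
    {V : ι → Π y : M, TangentSpace 𝓘(ℝ, F) (φ y)} (hφ : ContMDiffAt 𝓘(ℝ, E) 𝓘(ℝ, F) ∞ φ x)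
    (h : ∀ i ∈ s, SmoothAlongAt E F φ (V i) x) (v : TangentSpace 𝓘(ℝ, E) x) :
    pullbackConn φ (fun y => ∑ i ∈ s, V i y) x v = ∑ i ∈ s, pullbackConn φ (V i) x v := by
  classical
  induction s using Finset.induction_on with
  | empty => simpa using pullbackConn_zero hφ v
  | insert i s hi ih =>
    have hs : ∀ j ∈ s, SmoothAlongAt E F φ (V j) x :=
      fun j hj => h j (Finset.mem_insert_of_mem hj)
    simp only [Finset.sum_insert hi]
    rw [pullbackConn_add (h i (Finset.mem_insert_self i s)) (SmoothAlongAt.sum hφ hs), ih hs]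

/-- Both sides are computed in the preferred chart at `ψ (φ x)`, so the ordinary chain rule matches
the derivative terms and the Christoffel terms. -/
theorem pullbackConn_comp {G : Type*} [NormedAddCommGroup G] [NormedSpace ℝ G]
    [FiniteDimensional ℝ G] {P : Type*} [TopologicalSpace P] [ChartedSpace G P]
    [IsManifold 𝓘(ℝ, G) ∞ P] [Bundle.RiemannianBundle (fun y : P => TangentSpace 𝓘(ℝ, G) y)]
    {ψ : N → P} {Y : Π p : N, TangentSpace 𝓘(ℝ, G) (ψ p)}
    (hY : SmoothAlongAt F G ψ Y (φ x)) (hφ : ContMDiffAt 𝓘(ℝ, E) 𝓘(ℝ, F) ∞ φ x)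
    (v : TangentSpace 𝓘(ℝ, E) x) :
    pullbackConn (fun y => ψ (φ y)) (fun y => Y (φ y)) x v =
      pullbackConn ψ Y (φ x) (mfderiv 𝓘(ℝ, E) 𝓘(ℝ, F) φ x v) := by
  have hd := hφ.mdifferentiableAt (n := ∞) (by simp)
  have h : coordDeriv (fun y => ψ (φ y)) (fun y => Y (φ y)) x v =
      coordDeriv ψ Y (φ x) (mfderiv 𝓘(ℝ, E) 𝓘(ℝ, F) φ x v) :=
    mvfderiv_comp_map (f := fun p => coord (ψ (φ x)) (ψ p) (Y p))
      ((hY.coord (mem_chart_source G _)).mdifferentiableAt (by simp)) hd v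
  have h' : mfderiv 𝓘(ℝ, E) 𝓘(ℝ, G) (fun y => ψ (φ y)) x v =
      mfderiv 𝓘(ℝ, F) 𝓘(ℝ, G) ψ (φ x) (mfderiv 𝓘(ℝ, E) 𝓘(ℝ, F) φ x v) :=
    congrArg (fun T => T v) (mfderiv_comp x (hY.base.mdifferentiableAt (by simp)) hd)
  rw [pullbackConn_apply (φ := fun y => ψ (φ y)) (hY.base.comp x hφ), pullbackConn_apply hY.base, h, h']

theorem pullbackConn_comp_section {Y : Π p : N, TangentSpace 𝓘(ℝ, F) p}
    (hY : SmoothAlongAt F F (fun p => p) Y (φ x)) (hφ : ContMDiffAt 𝓘(ℝ, E) 𝓘(ℝ, F) ∞ φ x)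
    (v : TangentSpace 𝓘(ℝ, E) x) :
    pullbackConn φ (fun y => Y (φ y)) x v =
      leviCivita Y (φ x) (mfderiv 𝓘(ℝ, E) 𝓘(ℝ, F) φ x v) := by
  rw [← pullbackConn_id]
  exact pullbackConn_comp hY hφ v

variable [IsContMDiffRiemannianBundle 𝓘(ℝ, F) ∞ F (fun y : N => TangentSpace 𝓘(ℝ, F) y)]

theorem SmoothAlongAt.inner (hV : SmoothAlongAt E F φ V x) (hV' : SmoothAlongAt E F φ V' x) :
    ContMDiffAt 𝓘(ℝ, E) 𝓘(ℝ, ℝ) ∞ (fun y => (inner ℝ (V y) (V' y) : ℝ)) x :=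
  ContMDiffAt.inner_bundle hV hV'

theorem mvfderiv_inner (hV : SmoothAlongAt E F φ V x) (hV' : SmoothAlongAt E F φ V' x)
    (v : TangentSpace 𝓘(ℝ, E) x) :
    mvfderiv 𝓘(ℝ, E) (fun y => (inner ℝ (V y) (V' y) : ℝ)) x v =
      inner ℝ (pullbackConn φ V x v) (V' x) + inner ℝ (V x) (pullbackConn φ V' x v) := by
  have hs := mem_chart_source F (φ x)
  have hA : MDifferentiableAt 𝓘(ℝ, F) 𝓘(ℝ, F →L[ℝ] F →L[ℝ] ℝ) (metricCoord (E := F) (φ x))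
      (φ x) := (contMDiffAt_metricCoord hs).mdifferentiableAt (by simp)
  have hφ := hV.base.mdifferentiableAt (n := ∞) (by simp)
  have hc := (hV.coord hs).mdifferentiableAt (by simp)
  have hc' := (hV'.coord hs).mdifferentiableAt (by simp)
  have hAφ := MDifferentiableAt.comp x hA hφ
  have e : (fun y => (inner ℝ (V y) (V' y) : ℝ)) =ᶠ[𝓝 x]
      fun y => metricCoord (φ x) (φ y) (coord (φ x) (φ y) (V y)) (coord (φ x) (φ y) (V' y)) := by
    filter_upwards [hV.eventually_mem_source hs] with y hy
    exact (metricCoord_coord hy _ _).symm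
  have hD : mvfderiv 𝓘(ℝ, E) (fun y => metricCoord (E := F) (φ x) (φ y)) x v (V x) (V' x) =
      metricDerivAt (φ x) (mfderiv 𝓘(ℝ, E) 𝓘(ℝ, F) φ x v) (V x) (V' x) :=
    congrArg (fun T => T (V x) (V' x)) (mvfderiv_comp_map hA hφ v)
  -- The inner product is a bilinear form depending on the point, applied to two coordinate vectors.
  -- Two product rules give three terms; `christoffel_metric` splits the derivative of the form into
  -- the two Christoffel corrections.
  have key := mvfderiv_clm_apply (hAφ.clm_apply hc) hc' v
  have key' := mvfderiv_clm_apply hAφ hc v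
  simp only [Function.comp_def] at key key'
  rw [key', add_apply, coord_self, coord_self, hD] at key
  rw [mvfderiv, e.mfderiv_eq]
  refine (key.trans (congrArg₂ (· + ·) (congrArg₂ (· + ·) rfl
    (metricCoord_self (φ x) (coordDeriv φ V x v) (V' x)))
    (metricCoord_self (φ x) (V x) (coordDeriv φ V' x v)))).trans ?_
  rw [pullbackConn_apply hV.base, pullbackConn_apply hV.base, inner_add_left, inner_add_right,
    ← christoffel_metric]
  ring

end PullbackConn

/-! ### Koszul formula and smoothness of the Levi-Civita connection -/

section LeviCivita

variable {F : Type*} [NormedAddCommGroup F] [NormedSpace ℝ F] [FiniteDimensional ℝ F]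
  {N : Type*} [TopologicalSpace N] [ChartedSpace F N] [IsManifold 𝓘(ℝ, F) ∞ N]
  [Bundle.RiemannianBundle (fun y : N => TangentSpace 𝓘(ℝ, F) y)]

theorem leviCivita_congr {Y Z : Π p : N, TangentSpace 𝓘(ℝ, F) p} {p : N}
    (h : ∀ᶠ z in 𝓝 p, Y z = Z z) : leviCivita Y p = leviCivita Z p := by
  rw [← pullbackConn_id, ← pullbackConn_id]
  exact pullbackConn_congr h

variable [IsContMDiffRiemannianBundle 𝓘(ℝ, F) ∞ F (fun y : N => TangentSpace 𝓘(ℝ, F) y)]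

theorem mvfderiv_inner_leviCivita {Y Z : Π p : N, TangentSpace 𝓘(ℝ, F) p} {p : N}
    (hY : SmoothAlongAt F F (fun p => p) Y p) (hZ : SmoothAlongAt F F (fun p => p) Z p)
    (v : TangentSpace 𝓘(ℝ, F) p) :
    mvfderiv 𝓘(ℝ, F) (fun y => (inner ℝ (Y y) (Z y) : ℝ)) p v =
      inner ℝ (leviCivita Y p v) (Z p) + inner ℝ (Y p) (leviCivita Z p v) := by
  rw [← pullbackConn_id, ← pullbackConn_id]
  exact mvfderiv_inner hY hZ v

/-- Torsion-freeness at a point `p` other than the centre `q`. The coordinates of `frame q v` in the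
chart at `p` are the derivative of that chart along `frame q v`, so the derivative terms are mixed
second derivatives, and the Christoffel terms are symmetric. -/
theorem leviCivita_frame_symm {q p : N} (hp : p ∈ (chartAt F q).source) (u t : F) :
    leviCivita (frame q t) p (frame q u p) = leviCivita (frame q u) p (frame q t p) := by
  have h : ∀ v w : F, coordDeriv (fun p => p) (frame q v) p (frame q w p) =
      (mvfderiv 𝓘(ℝ, F) (fun z => mvfderiv 𝓘(ℝ, F) (extChartAt 𝓘(ℝ, F) p) z (frame q v z)) p
        (frame q w p) : F) := by
    intro v w
    have e : (fun z => coord p z (frame q v z)) =ᶠ[𝓝 p]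
        fun z => mvfderiv 𝓘(ℝ, F) (extChartAt 𝓘(ℝ, F) p) z (frame q v z) := by
      filter_upwards [eventually_mem_chart_source (mem_chart_source F p)] with z hz
      exact coord_eq_mfderiv hz _
    rw [coordDeriv, mvfderiv, e.mfderiv_eq]
    rfl
  have h' : coordDeriv (fun p => p) (frame q t) p (frame q u p) =
      coordDeriv (fun p => p) (frame q u) p (frame q t p) := by
    refine (h t u).trans (Eq.trans ?_ (h u t).symm)
    exact mvfderiv_frame_comm hp (contMDiffAt_extChartAt' (mem_chart_source F p)) u t
  have e : mfderiv 𝓘(ℝ, F) 𝓘(ℝ, F) (fun p : N => p) p = ContinuousLinearMap.id ℝ _ := mfderiv_id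
  rw [← pullbackConn_id, ← pullbackConn_id, pullbackConn_apply (φ := fun p : N => p) contMDiffAt_id,
    pullbackConn_apply (φ := fun p : N => p) contMDiffAt_id, h', e]
  congr 1
  exact christoffel_symm _ _ _

/-- Metric compatibility and vanishing torsion determine the connection; no bracket terms appear for
coordinate fields. The right side refers only to the chart at `q`, hence is visibly smooth in `p`.
-/
theorem koszul_frame {q p : N} (hp : p ∈ (chartAt F q).source) (u t w : F) :
    inner ℝ (leviCivita (frame q t) p (frame q u p)) (frame q w p) = (1 / 2 : ℝ) *
      (mvfderiv 𝓘(ℝ, F) (fun z => (inner ℝ (frame q t z) (frame q w z) : ℝ)) p (frame q u p)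
      + mvfderiv 𝓘(ℝ, F) (fun z => (inner ℝ (frame q u z) (frame q w z) : ℝ)) p (frame q t p)
      - mvfderiv 𝓘(ℝ, F) (fun z => (inner ℝ (frame q t z) (frame q u z) : ℝ)) p (frame q w p)) := by
  have hs : ∀ v : F, SmoothAlongAt F F (fun p => p) (frame q v) p := contMDiffAt_frame hp
  rw [mvfderiv_inner_leviCivita (hs t) (hs w), mvfderiv_inner_leviCivita (hs u) (hs w),
    mvfderiv_inner_leviCivita (hs t) (hs u), leviCivita_frame_symm hp u w,
    leviCivita_frame_symm hp t w, leviCivita_frame_symm hp t u, real_inner_comm (frame q u p)]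
  ring

/-- Injectivity is positive definiteness; surjectivity is the Riesz representation in the tangent
space at `p`. -/
theorem metricCoord_isInvertible {q p : N} (hp : p ∈ (chartAt F q).source) :
    (metricCoord (E := F) q p).IsInvertible := by
  have hinj : Function.Injective (metricCoord (E := F) q p).toLinearMap := by
    refine (injective_iff_map_eq_zero _).2 fun v hv => ?_
    have h : metricCoord q p v v = 0 := congrArg (fun T : F →L[ℝ] ℝ => T v) hv
    rw [metricCoord_apply, inner_self_eq_zero] at h
    rw [← coord_frame hp v, h, map_zero]
  have hsurj : Function.Surjective (metricCoord (E := F) q p).toLinearMap := by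
    intro a
    let a' : TangentSpace 𝓘(ℝ, F) p →L[ℝ] ℝ := a.comp (coord q p)
    refine ⟨coord q p ((InnerProductSpace.toDual ℝ (TangentSpace 𝓘(ℝ, F) p)).symm a'), ?_⟩
    ext w
    have h := metricCoord_coord hp
      ((InnerProductSpace.toDual ℝ (TangentSpace 𝓘(ℝ, F) p)).symm a') (frame q w p)
    rw [coord_frame hp, InnerProductSpace.toDual_symm_apply] at h
    refine h.trans ?_
    change a (coord q p (frame q w p)) = a w
    rw [coord_frame hp]
  exact ⟨(LinearEquiv.ofBijective _ ⟨hinj, hsurj⟩).toContinuousLinearEquiv, by ext; rfl⟩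

/-- In coordinates `♯` applies the inverse of the metric form, and inversion is smooth on invertible
operators. It suffices to test a field by its pairings with coordinate fields. -/
theorem smoothAlongAt_sharp {α : Π p : N, TangentSpace 𝓘(ℝ, F) p →L[ℝ] ℝ} {q p : N}
    (hp : p ∈ (chartAt F q).source)
    (h : ∀ u, ContMDiffAt 𝓘(ℝ, F) 𝓘(ℝ, ℝ) ∞ (fun y => α y (frame q u y)) p) :
    SmoothAlongAt F F (fun p => p) (sharp α) p := by
  refine (SmoothAlongAt.iff_coord hp).2 ⟨contMDiffAt_id, ?_⟩
  let a : N → F →L[ℝ] ℝ := fun y =>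
    (α y).comp ((trivializationAt F (TangentSpace 𝓘(ℝ, F)) q).symmL ℝ y)
  have ha : ContMDiffAt 𝓘(ℝ, F) 𝓘(ℝ, F →L[ℝ] ℝ) ∞ a p := contMDiffAt_clm_of_apply h
  obtain ⟨e, he⟩ := metricCoord_isInvertible hp
  have hinv : ContMDiffAt 𝓘(ℝ, F) 𝓘(ℝ, (F →L[ℝ] ℝ) →L[ℝ] F) ∞
      (fun y => (metricCoord (E := F) q y).inverse) p := by
    have h1 : ContDiffAt ℝ ∞ ContinuousLinearMap.inverse (metricCoord (E := F) q p) := by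
      rw [← he]
      have : CompleteSpace F := FiniteDimensional.complete ℝ F
      exact contDiffAt_map_inverse e
    exact ContMDiffAt.comp p h1.contMDiffAt (contMDiffAt_metricCoord hp)
  refine (hinv.clm_apply ha).congr_of_eventuallyEq ?_
  filter_upwards [eventually_mem_chart_source hp] with y hy
  have : metricCoord q y (coord q y (sharp α y)) = a y := by
    ext w
    have h := metricCoord_coord hy (sharp α y) (frame q w y)
    rw [coord_frame hy] at h
    refine h.trans ?_
    rw [sharp, InnerProductSpace.toDual_symm_apply]
    rfl
  rw [← this, (metricCoord_isInvertible hy).inverse_apply_self]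

theorem sharp_inner (Y : Π p : N, TangentSpace 𝓘(ℝ, F) p) :
    sharp (fun p => innerSL ℝ (E := TangentSpace 𝓘(ℝ, F) p) (Y p)) = Y := by
  funext p
  exact (InnerProductSpace.toDual ℝ (TangentSpace 𝓘(ℝ, F) p)).symm_apply_apply (Y p)

theorem smoothAlongAt_leviCivita_frame {q p : N} (hp : p ∈ (chartAt F q).source) (u t : F) :
    SmoothAlongAt F F (fun p => p) (fun y => leviCivita (frame q t) y (frame q u y)) p := by
  rw [← sharp_inner fun y => leviCivita (frame q t) y (frame q u y)]
  refine smoothAlongAt_sharp hp fun w => ?_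
  have hs : ∀ v : F, SmoothAlongAt F F (fun p => p) (frame q v) p := contMDiffAt_frame hp
  have h : ∀ v w z : F, ContMDiffAt 𝓘(ℝ, F) 𝓘(ℝ, ℝ) ∞ (fun y => mvfderiv 𝓘(ℝ, F)
      (fun z => (inner ℝ (frame q v z) (frame q w z) : ℝ)) y (frame q z y)) p :=
    fun v w z => contMDiffAt_mvfderiv ((hs v).inner (hs w)) (hs z)
  have h1 := (contMDiffAt_const (c := (1 / 2 : ℝ))).mul (((h t w u).add (h u w t)).sub (h t u w))
  refine h1.congr_of_eventuallyEq ?_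
  filter_upwards [eventually_mem_chart_source hp] with y hy
  exact koszul_frame hy u t w

end LeviCivita

/-! ### Smoothness of covariant derivatives along a map -/

section PullbackConnSmooth

variable {E : Type*} [NormedAddCommGroup E] [NormedSpace ℝ E]
  {M : Type*} [TopologicalSpace M] [ChartedSpace E M] [IsManifold 𝓘(ℝ, E) ∞ M]
  {F : Type*} [NormedAddCommGroup F] [NormedSpace ℝ F] [FiniteDimensional ℝ F]
  {N : Type*} [TopologicalSpace N] [ChartedSpace F N] [IsManifold 𝓘(ℝ, F) ∞ N]
  [Bundle.RiemannianBundle (fun y : N => TangentSpace 𝓘(ℝ, F) y)]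
  {φ : M → N} {V : Π y : M, TangentSpace 𝓘(ℝ, F) (φ y)} {x : M}

theorem pullbackConn_eq_sum {q : N} (hq : φ x ∈ (chartAt F q).source)
    (hV : SmoothAlongAt E F φ V x) (v : TangentSpace 𝓘(ℝ, E) x) :
    pullbackConn φ V x v = ∑ j,
      (mvfderiv 𝓘(ℝ, E) (fun y => component q (φ y) j (V y)) x v •
          frame q (Module.finBasis ℝ F j) (φ x)
        + component q (φ x) j (V x) • leviCivita (frame q (Module.finBasis ℝ F j)) (φ x)
          (mfderiv 𝓘(ℝ, E) 𝓘(ℝ, F) φ x v)) := by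
  have e : ∀ᶠ y in 𝓝 x, V y = ∑ j, component q (φ y) j (V y) •
      frame q (Module.finBasis ℝ F j) (φ y) := by
    filter_upwards [hV.eventually_mem_source hq] with y hy
    exact (sum_component_smul_frame hy (V y)).symm
  have hB : ∀ j, SmoothAlongAt E F φ (fun y => frame q (Module.finBasis ℝ F j) (φ y)) x :=
    fun j => SmoothAlongAt.frame hV.base hq _
  rw [pullbackConn_congr e, pullbackConn_sum _ hV.base
    fun j _ => (hB j).smul (hV.component hq j)]
  refine Finset.sum_congr rfl fun j _ => ?_
  rw [pullbackConn_smul (hV.component hq j) (hB j),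
    pullbackConn_comp_section (contMDiffAt_frame hq _) hV.base]

variable [IsContMDiffRiemannianBundle 𝓘(ℝ, F) ∞ F (fun y : N => TangentSpace 𝓘(ℝ, F) y)]

/-- Expanding `V` and `dφ(U)` in the frame of the chart at `φ x` leaves smooth coefficients and the
fields `∇_{frame k} frame j`. Smoothness of `V` is required near `x`, since order `∞` at a point
yields only a neighbourhood for each finite order. -/
theorem SmoothAlongAt.pullbackConn {U : Π y : M, TangentSpace 𝓘(ℝ, E) y}
    (hV : ∀ᶠ y in 𝓝 x, SmoothAlongAt E F φ V y) (hU : SmoothAlongAt E E (fun y => y) U x) :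
    SmoothAlongAt E F φ (fun y => pullbackConn φ V y (U y)) x := by
  have hq := mem_chart_source F (φ x)
  have hVx := hV.self_of_nhds
  have hdU := SmoothAlongAt.mfderiv hVx.base hU
  let b := Module.finBasis ℝ F
  have e : ∀ᶠ y in 𝓝 x, BiharmonicCurrent.pullbackConn φ V y (U y) = ∑ j,
      (mvfderiv 𝓘(ℝ, E) (fun y => BiharmonicCurrent.component (φ x) (φ y) j (V y)) y (U y) •
          BiharmonicCurrent.frame (φ x) (b j) (φ y)
        + BiharmonicCurrent.component (φ x) (φ y) j (V y) •
          ∑ k, BiharmonicCurrent.component (φ x) (φ y) k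
              (_root_.mfderiv 𝓘(ℝ, E) 𝓘(ℝ, F) φ y (U y)) •
            leviCivita (BiharmonicCurrent.frame (φ x) (b j)) (φ y)
              (BiharmonicCurrent.frame (φ x) (b k) (φ y))) := by
    filter_upwards [hV, hVx.eventually_mem_source hq] with y hy hys
    rw [pullbackConn_eq_sum hys hy]
    refine Finset.sum_congr rfl fun j _ => ?_
    congr 2
    conv_lhs => rw [← sum_component_smul_frame hys (_root_.mfderiv 𝓘(ℝ, E) 𝓘(ℝ, F) φ y (U y))]
    simp only [map_sum, map_smul, b]
  refine SmoothAlongAt.congr ?_ e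
  refine SmoothAlongAt.sum hVx.base fun j _ => ?_
  refine SmoothAlongAt.add (SmoothAlongAt.smul (contMDiffAt_mvfderiv (hVx.component hq j) hU)
    (SmoothAlongAt.frame hVx.base hq _)) (SmoothAlongAt.smul (hVx.component hq j) ?_)
  refine SmoothAlongAt.sum hVx.base fun k _ => SmoothAlongAt.smul (hdU.component hq k) ?_
  exact SmoothAlongAt.comp (smoothAlongAt_leviCivita_frame hq _ _) hVx.base

theorem SmoothAlongAt.leviCivita {Y U : Π p : N, TangentSpace 𝓘(ℝ, F) p} {p : N}
    (hY : ∀ᶠ y in 𝓝 p, SmoothAlongAt F F (fun p => p) Y y)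
    (hU : SmoothAlongAt F F (fun p => p) U p) :
    SmoothAlongAt F F (fun p => p) (fun y => leviCivita Y y (U y)) p := by
  have h := SmoothAlongAt.pullbackConn hY hU
  simp only [pullbackConn_id] at h
  exact h

end PullbackConnSmooth

/-! ### Tensoriality and product rules for covariant derivatives of one-forms -/

section Tensoriality

variable {E : Type*} [NormedAddCommGroup E] [NormedSpace ℝ E] [FiniteDimensional ℝ E]
  {M : Type*} [TopologicalSpace M] [ChartedSpace E M] [IsManifold 𝓘(ℝ, E) ∞ M]
  [Bundle.RiemannianBundle (fun y : M => TangentSpace 𝓘(ℝ, E) y)]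
  {F : Type*} [NormedAddCommGroup F] [NormedSpace ℝ F] [FiniteDimensional ℝ F]
  {N : Type*} [TopologicalSpace N] [ChartedSpace F N] [IsManifold 𝓘(ℝ, F) ∞ N]
  [Bundle.RiemannianBundle (fun y : N => TangentSpace 𝓘(ℝ, F) y)]
  {φ : M → N} {A : Π y : M, TangentSpace 𝓘(ℝ, E) y →L[ℝ] TangentSpace 𝓘(ℝ, F) (φ y)}

theorem pullbackConnOneForm_eq_frame (x : M) (u v : TangentSpace 𝓘(ℝ, E) x) :
    pullbackConnOneForm φ A x u v =
      pullbackConn φ (fun y => A y (frame (E := E) x v y)) x u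
        - A x (leviCivita (frame (E := E) x v) x u) := by
  have e := extend_eventuallyEq_frame v
  rw [pullbackConnOneForm, leviCivita_congr e,
    pullbackConn_congr (e.mono fun y hy => congrArg (A y) hy)]

/-- Near `x` the extension of `v` is a constant-coefficient combination of coordinate fields, so no
derivatives of coefficients arise. This makes linearity in `v` evident. -/
theorem pullbackConnOneForm_eq_sum {x : M}
    (hA : ∀ u : E, SmoothAlongAt E F φ (fun y => A y (frame x u y)) x)
    (u v : TangentSpace 𝓘(ℝ, E) x) :
    pullbackConnOneForm φ A x u v = ∑ j, component x x j v •
      (pullbackConn φ (fun y => A y (frame x (Module.finBasis ℝ E j) y)) x u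
        - A x (leviCivita (frame x (Module.finBasis ℝ E j)) x u)) := by
  let c : Fin (Module.finrank ℝ E) → ℝ := fun j => component x x j v
  let b := Module.finBasis ℝ E
  have hv : ∀ y : M, frame (E := E) x v y = ∑ j, c j • frame x (b j) y := by
    intro y
    rw [← frame_sum]
    congr 1
    have h := sum_component_smul_frame (mem_chart_source E x) v
    simp only [frame_self] at h
    exact h.symm
  have hs : ∀ j, SmoothAlongAt E E (fun y => y) (frame x (b j)) x :=
    fun j => contMDiffAt_frame (mem_chart_source E x) _
  have hφ := (hA 0).base
  have h1 : pullbackConn φ (fun y => A y (frame (E := E) x v y)) x u =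
      ∑ j, c j • pullbackConn φ (fun y => A y (frame x (b j) y)) x u := by
    simp only [hv, map_sum, map_smul]
    rw [pullbackConn_sum _ hφ fun j _ => (hA (b j)).smul contMDiffAt_const]
    refine Finset.sum_congr rfl fun j _ => ?_
    rw [pullbackConn_smul contMDiffAt_const (hA (b j)), mvfderiv_const]
    simp
  have h2 : leviCivita (frame (E := E) x v) x u = ∑ j, c j • leviCivita (frame x (b j)) x u := by
    have hv' : frame (E := E) x v = fun y => ∑ j, c j • frame x (b j) y := funext hv
    simp only [hv', ← pullbackConn_id]
    rw [pullbackConn_sum (φ := fun y : M => y) _ contMDiffAt_id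
      fun j _ => (hs j).smul contMDiffAt_const]
    refine Finset.sum_congr rfl fun j _ => ?_
    rw [pullbackConn_smul contMDiffAt_const (hs j), mvfderiv_const]
    simp
  rw [pullbackConnOneForm_eq_frame, h1, h2, map_sum, ← Finset.sum_sub_distrib]
  refine Finset.sum_congr rfl fun j _ => ?_
  rw [map_smul, smul_sub]

/-- The covariant derivative of `A : TN → ψ^* TP` satisfies the product rule on vector fields
along a map with values in `N`. -/
theorem pullbackConn_clm_apply {D : Type*} [NormedAddCommGroup D] [NormedSpace ℝ D]
    {L : Type*} [TopologicalSpace L] [ChartedSpace D L] [IsManifold 𝓘(ℝ, D) ∞ L]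
    {χ : L → M} {x : L} {W : Π y : L, TangentSpace 𝓘(ℝ, E) (χ y)}
    (hA : ∀ u : E, SmoothAlongAt E F φ (fun y => A y (frame (χ x) u y)) (χ x))
    (hW : SmoothAlongAt D E χ W x) (v : TangentSpace 𝓘(ℝ, D) x) :
    pullbackConn (fun y => φ (χ y)) (fun y => A (χ y) (W y)) x v =
      A (χ x) (pullbackConn χ W x v)
        + pullbackConnOneForm φ A (χ x) (mfderiv 𝓘(ℝ, D) 𝓘(ℝ, E) χ x v) (W x) := by
  have hs := mem_chart_source E (χ x)
  let b := Module.finBasis ℝ E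
  have e : ∀ᶠ y in 𝓝 x, A (χ y) (W y) = ∑ j, component (χ x) (χ y) j (W y) •
      A (χ y) (frame (χ x) (b j) (χ y)) := by
    filter_upwards [hW.eventually_mem_source hs] with y hy
    conv_lhs => rw [← sum_component_smul_frame hy (W y)]
    simp only [map_sum, map_smul, b]
  have hB : ∀ j, SmoothAlongAt D F (fun y => φ (χ y))
      (fun y => A (χ y) (frame (χ x) (b j) (χ y))) x :=
    fun j => ContMDiffAt.comp (I' := 𝓘(ℝ, E)) x (hA (b j)) hW.base
  have hφ : ContMDiffAt 𝓘(ℝ, D) 𝓘(ℝ, F) ∞ (fun y => φ (χ y)) x := (hA 0).base.comp x hW.base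
  rw [pullbackConn_congr (φ := fun y => φ (χ y)) e, pullbackConn_sum _ hφ
    fun j _ => (hB j).smul (hW.component hs j), pullbackConnOneForm_eq_sum hA,
    pullbackConn_eq_sum hs hW, map_sum, ← Finset.sum_add_distrib]
  -- The terms with differentiated components of `W` agree on both sides; the rest is the component
  -- of `W` times the covariant derivative of `A` on a frame vector.
  refine Finset.sum_congr rfl fun j _ => ?_
  rw [pullbackConn_smul (hW.component hs j) (hB j), pullbackConn_comp (hA (b j)) hW.base]
  simp only [map_add, map_smul, smul_sub]
  abel

theorem pullbackConnOneForm_apply_section {x : M} {Z : Π y : M, TangentSpace 𝓘(ℝ, E) y}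
    (hA : ∀ u : E, SmoothAlongAt E F φ (fun y => A y (frame x u y)) x)
    (hZ : SmoothAlongAt E E (fun y => y) Z x) (u : TangentSpace 𝓘(ℝ, E) x) :
    pullbackConnOneForm φ A x u (Z x) =
      pullbackConn φ (fun y => A y (Z y)) x u - A x (leviCivita Z x u) := by
  have h := pullbackConn_clm_apply (χ := fun y : M => y) hA hZ u
  have e : mfderiv 𝓘(ℝ, E) 𝓘(ℝ, E) (fun p : M => p) x = ContinuousLinearMap.id ℝ _ := mfderiv_id
  rw [pullbackConn_id, e] at h
  rw [h]
  exact (add_sub_cancel_left _ _).symm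

/-- The orthonormal basis is chosen separately at each point, with no continuity. Expanding the dual
frame `sharp (component q · j)` in that basis turns the trace into a sum over fields that vary
smoothly. -/
theorem metricTrace_eq_sum {W : Type*} [AddCommGroup W] [Module ℝ W] {q x : M}
    (hx : x ∈ (chartAt E q).source)
    (B : TangentSpace 𝓘(ℝ, E) x →ₗ[ℝ] TangentSpace 𝓘(ℝ, E) x →ₗ[ℝ] W) :
    metricTrace x (fun u v => B u v) = ∑ j,
      B (sharp (fun y => component q y j) x) (frame q (Module.finBasis ℝ E j) x) := by
  let e := stdOrthonormalBasis ℝ (TangentSpace 𝓘(ℝ, E) x)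
  have h : ∀ j, sharp (fun y => component q y j) x = ∑ i, component q x j (e i) • e i := by
    intro j
    conv_lhs => rw [← e.sum_repr (sharp (fun y => component q y j) x)]
    refine Finset.sum_congr rfl fun i _ => ?_
    rw [e.repr_apply_apply, real_inner_comm, sharp, InnerProductSpace.toDual_symm_apply]
  simp only [h, map_sum, map_smul, LinearMap.sum_apply, LinearMap.smul_apply]
  rw [Finset.sum_comm, metricTrace]
  refine Finset.sum_congr rfl fun i _ => ?_
  have h1 := congrArg (B (e i)) (sum_component_smul_frame hx (e i))
  simp only [map_sum, map_smul] at h1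
  exact h1.symm

end Tensoriality

/-! ### Curvature and the second derivative of a Killing field -/

section Killing

variable {F : Type*} [NormedAddCommGroup F] [NormedSpace ℝ F] [FiniteDimensional ℝ F]
  {N : Type*} [TopologicalSpace N] [ChartedSpace F N] [IsManifold 𝓘(ℝ, F) ∞ N]
  [Bundle.RiemannianBundle (fun y : N => TangentSpace 𝓘(ℝ, F) y)]
  {X Y Z : Π p : N, TangentSpace 𝓘(ℝ, F) p} {q : N}

theorem curvatureField_extend (u t : TangentSpace 𝓘(ℝ, F) q) :
    curvatureField (FiberBundle.extend F u) (FiberBundle.extend F t) Z q =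
      leviCivita (fun y => leviCivita Z y (FiberBundle.extend F t y)) q u
        - leviCivita (fun y => leviCivita Z y (FiberBundle.extend F u y)) q t := by
  rw [curvatureField, mlieBracket_extend, map_zero, sub_zero, FiberBundle.extend_apply_self,
    FiberBundle.extend_apply_self]

/-- The second covariant derivative `∇_a (∇_b Z) - ∇_{∇_a b} Z`. -/
def secondDeriv (Z : Π p : N, TangentSpace 𝓘(ℝ, F) p) (q : N) (a b : TangentSpace 𝓘(ℝ, F) q) :
    TangentSpace 𝓘(ℝ, F) q :=
  leviCivita (fun y => leviCivita Z y (FiberBundle.extend F b y)) q a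
    - leviCivita Z q (leviCivita (FiberBundle.extend F b) q a)

theorem pullbackConnOneForm_leviCivita (a b : TangentSpace 𝓘(ℝ, F) q) :
    pullbackConnOneForm (fun p => p) (leviCivita Z) q a b = secondDeriv Z q a b := by
  rw [pullbackConnOneForm, pullbackConn_id, secondDeriv]

variable [IsContMDiffRiemannianBundle 𝓘(ℝ, F) ∞ F (fun y : N => TangentSpace 𝓘(ℝ, F) y)]

theorem leviCivita_extend_symm (u t : TangentSpace 𝓘(ℝ, F) q) :
    leviCivita (FiberBundle.extend F t) q u = leviCivita (FiberBundle.extend F u) q t := by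
  rw [leviCivita_congr (extend_eventuallyEq_frame t), leviCivita_congr (extend_eventuallyEq_frame u)]
  have h := leviCivita_frame_symm (mem_chart_source F q) u t
  have hu : frame (E := F) q u q = u := frame_self (E := F) q u
  have ht : frame (E := F) q t q = t := frame_self (E := F) q t
  rwa [hu, ht] at h

/-- The Ricci identity: the brackets of the extensions vanish at `q`, and the first-order
corrections agree because the torsion is zero. -/
theorem curvatureField_eq_secondDeriv (u t : TangentSpace 𝓘(ℝ, F) q) :
    curvatureField (FiberBundle.extend F u) (FiberBundle.extend F t) Z q =
      secondDeriv Z q u t - secondDeriv Z q t u := by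
  rw [curvatureField_extend, secondDeriv, secondDeriv, leviCivita_extend_symm u t]
  abel

theorem mvfderiv_congr {f g : N → ℝ} (h : f =ᶠ[𝓝 q] g) :
    mvfderiv 𝓘(ℝ, F) f q = mvfderiv 𝓘(ℝ, F) g q := by
  have h' := h.mfderiv_eq (I := 𝓘(ℝ, F)) (I' := 𝓘(ℝ, ℝ))
  ext v
  exact congrArg (fun T : F →L[ℝ] ℝ => T v) h'

theorem mvfderiv_extend_comm {f : N → ℝ} (hf : ContMDiffAt 𝓘(ℝ, F) 𝓘(ℝ, ℝ) ∞ f q)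
    (u t : TangentSpace 𝓘(ℝ, F) q) :
    mvfderiv 𝓘(ℝ, F) (fun z => mvfderiv 𝓘(ℝ, F) f z (FiberBundle.extend F t z)) q u =
      mvfderiv 𝓘(ℝ, F) (fun z => mvfderiv 𝓘(ℝ, F) f z (FiberBundle.extend F u z)) q t := by
  have e : ∀ v : TangentSpace 𝓘(ℝ, F) q,
      (fun z => mvfderiv 𝓘(ℝ, F) f z (FiberBundle.extend F v z)) =ᶠ[𝓝 q]
        fun z => mvfderiv 𝓘(ℝ, F) f z (frame (E := F) q v z) := fun v => by
    filter_upwards [extend_eventuallyEq_frame v] with z hz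
    rw [hz]
  have h := mvfderiv_frame_comm (mem_chart_source F q) hf u t
  have hu : frame (E := F) q u q = u := frame_self (E := F) q u
  have ht : frame (E := F) q t q = t := frame_self (E := F) q t
  rw [hu, ht] at h
  rw [mvfderiv_congr (e t), mvfderiv_congr (e u)]
  exact h

/-- The curvature acts by skew-symmetric endomorphisms. -/
theorem inner_curvatureField_skew (hY : ∀ᶠ p in 𝓝 q, SmoothAlongAt F F (fun p => p) Y p)
    (hZ : ∀ᶠ p in 𝓝 q, SmoothAlongAt F F (fun p => p) Z p) (u t : TangentSpace 𝓘(ℝ, F) q) :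
    inner ℝ (curvatureField (FiberBundle.extend F u) (FiberBundle.extend F t) Y q) (Z q)
      + inner ℝ (Y q) (curvatureField (FiberBundle.extend F u) (FiberBundle.extend F t) Z q)
      = 0 := by
  have hYq := hY.self_of_nhds
  have hZq := hZ.self_of_nhds
  have key : ∀ a b : TangentSpace 𝓘(ℝ, F) q,
      mvfderiv 𝓘(ℝ, F) (fun z => mvfderiv 𝓘(ℝ, F) (fun p => (inner ℝ (Y p) (Z p) : ℝ)) z
        (FiberBundle.extend F b z)) q a =
      inner ℝ (leviCivita (fun y => leviCivita Y y (FiberBundle.extend F b y)) q a) (Z q)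
      + inner ℝ (leviCivita Y q b) (leviCivita Z q a)
      + (inner ℝ (leviCivita Y q a) (leviCivita Z q b)
      + inner ℝ (Y q) (leviCivita (fun y => leviCivita Z y (FiberBundle.extend F b y)) q a)) := by
    intro a b
    have hb := (eventually_smoothAlongAt_extend b).self_of_nhds
    have h1 := SmoothAlongAt.leviCivita hY hb
    have h2 := SmoothAlongAt.leviCivita hZ hb
    have e : (fun z => mvfderiv 𝓘(ℝ, F) (fun p => (inner ℝ (Y p) (Z p) : ℝ)) z
        (FiberBundle.extend F b z)) =ᶠ[𝓝 q]
        fun z => (inner ℝ (leviCivita Y z (FiberBundle.extend F b z)) (Z z) : ℝ)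
          + inner ℝ (Y z) (leviCivita Z z (FiberBundle.extend F b z)) := by
      filter_upwards [hY, hZ] with z hYz hZz
      exact mvfderiv_inner_leviCivita hYz hZz _
    rw [mvfderiv, e.mfderiv_eq]
    have h3 := mvfderiv_fun_add ((h1.inner hZq).mdifferentiableAt (by simp))
      ((hYq.inner h2).mdifferentiableAt (by simp))
    refine (congrArg (fun T => T a) h3).trans ?_
    rw [add_apply, mvfderiv_inner_leviCivita h1 hZq, mvfderiv_inner_leviCivita hYq h2,
      FiberBundle.extend_apply_self]
  -- Second derivatives of the function `⟨Y, Z⟩` commute, and the mixed terms in `key` are symmetric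
  -- in `a`, `b`; antisymmetrizing therefore leaves only the curvature terms.
  have h := mvfderiv_extend_comm (hYq.inner hZq) u t
  rw [key, key] at h
  rw [curvatureField_extend, curvatureField_extend, inner_sub_left, inner_sub_right]
  linarith

theorem IsKilling.smooth (hX : IsKilling X) (p : N) : SmoothAlongAt F F (fun p => p) X p :=
  hX.contMDiff p

theorem IsKilling.inner_leviCivita (hX : IsKilling X) (p : N) (u w : TangentSpace 𝓘(ℝ, F) p) :
    inner ℝ (leviCivita X p u) w + inner ℝ (leviCivita X p w) u = 0 :=
  hX.lieDerivMetric_eq_zero p u w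

/-- Differentiate the Killing equation, evaluated on the extensions of `b` and `c`, in the direction
`a`. The terms where the extensions are differentiated are absorbed by the Killing equation at `q`.
-/
theorem IsKilling.inner_secondDeriv (hX : IsKilling X) (a b c : TangentSpace 𝓘(ℝ, F) q) :
    inner ℝ (secondDeriv X q a b) c + inner ℝ (secondDeriv X q a c) b = 0 := by
  have hb := (eventually_smoothAlongAt_extend b).self_of_nhds
  have hc := (eventually_smoothAlongAt_extend c).self_of_nhds
  have hX' := Eventually.of_forall (f := 𝓝 q) hX.smooth
  have h1 := SmoothAlongAt.leviCivita hX' hb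
  have h2 := SmoothAlongAt.leviCivita hX' hc
  have e : (fun z => (inner ℝ (leviCivita X z (FiberBundle.extend F b z))
      (FiberBundle.extend F c z) : ℝ)
        + inner ℝ (leviCivita X z (FiberBundle.extend F c z)) (FiberBundle.extend F b z))
      = fun _ => (0 : ℝ) :=
    funext fun z => hX.inner_leviCivita z _ _
  have h3 := congrArg (fun T => T a) (mvfderiv_fun_add
    ((h1.inner hc).mdifferentiableAt (by simp)) ((h2.inner hb).mdifferentiableAt (by simp)))
  simp only [e, mvfderiv_const, add_apply, zero_apply] at h3
  rw [mvfderiv_inner_leviCivita h1 hc, mvfderiv_inner_leviCivita h2 hb] at h3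
  simp only [FiberBundle.extend_apply_self] at h3
  have h4 := hX.inner_leviCivita q b (leviCivita (FiberBundle.extend F c) q a)
  have h5 := hX.inner_leviCivita q c (leviCivita (FiberBundle.extend F b) q a)
  rw [secondDeriv, secondDeriv, inner_sub_left, inner_sub_left]
  linarith

/-- The second derivative of a Killing vector field is given by the curvature. -/
theorem IsKilling.inner_secondDeriv_self (hX : IsKilling X) (u t : TangentSpace 𝓘(ℝ, F) q) :
    inner ℝ (secondDeriv X q u u) t = inner ℝ (X q) (curvature q u t u) := by
  -- `h1` gives `⟨∇²X(u, u), t⟩ = -⟨∇²X(u, t), u⟩` and `h2` gives `⟨∇²X(t, u), u⟩ = 0`. Hence the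
  -- left side is `-⟨R(u, t)X, u⟩`, and skewness of the curvature finishes; no Bianchi identity is
  -- needed.
  have h1 := hX.inner_secondDeriv u u t
  have h2 := hX.inner_secondDeriv t u u
  have h3 := inner_curvatureField_skew (Eventually.of_forall (f := 𝓝 q) hX.smooth)
    (eventually_smoothAlongAt_extend u) u t
  rw [curvatureField_eq_secondDeriv, FiberBundle.extend_apply_self, inner_sub_left] at h3
  rw [curvature]
  linarith

end Killing

/-! ### The current: smoothness and divergence -/

section Current

variable {E : Type*} [NormedAddCommGroup E] [NormedSpace ℝ E] [FiniteDimensional ℝ E]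
  {M : Type*} [TopologicalSpace M] [ChartedSpace E M] [IsManifold 𝓘(ℝ, E) ∞ M]
  [Bundle.RiemannianBundle (fun x : M => TangentSpace 𝓘(ℝ, E) x)]
  {F : Type*} [NormedAddCommGroup F] [NormedSpace ℝ F] [FiniteDimensional ℝ F]
  {N : Type*} [TopologicalSpace N] [ChartedSpace F N] [IsManifold 𝓘(ℝ, F) ∞ N]
  [Bundle.RiemannianBundle (fun y : N => TangentSpace 𝓘(ℝ, F) y)]
  {φ : M → N}

/-- The covariant derivative of a smooth one-form, as a bilinear map. -/
def pullbackConnOneFormₗ {A : Π y : M, TangentSpace 𝓘(ℝ, E) y →L[ℝ] TangentSpace 𝓘(ℝ, F) (φ y)}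
    {x : M} (hA : ∀ u : E, SmoothAlongAt E F φ (fun y => A y (frame x u y)) x) :
    TangentSpace 𝓘(ℝ, E) x →ₗ[ℝ] TangentSpace 𝓘(ℝ, E) x →ₗ[ℝ] TangentSpace 𝓘(ℝ, F) (φ x) :=
  LinearMap.mk₂ ℝ (pullbackConnOneForm φ A x)
    (fun u u' v => by
      rw [pullbackConnOneForm, pullbackConnOneForm, pullbackConnOneForm]
      simp only [map_add]
      abel)
    (fun c u v => by
      rw [pullbackConnOneForm, pullbackConnOneForm]
      simp only [map_smul, smul_sub])
    (fun u v v' => by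
      simp only [pullbackConnOneForm_eq_sum hA, map_add, add_smul, Finset.sum_add_distrib])
    (fun c u v => by
      simp only [pullbackConnOneForm_eq_sum hA, map_smul, smul_assoc, Finset.smul_sum])

theorem smoothAlongAt_mfderiv_frame (hφ : ContMDiff 𝓘(ℝ, E) 𝓘(ℝ, F) ∞ φ) {q x : M}
    (hx : x ∈ (chartAt E q).source) (u : E) :
    SmoothAlongAt E F φ (fun y => mfderiv 𝓘(ℝ, E) 𝓘(ℝ, F) φ y (frame q u y)) x :=
  SmoothAlongAt.mfderiv hφ.contMDiffAt (contMDiffAt_frame hx u)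

variable [IsContMDiffRiemannianBundle 𝓘(ℝ, E) ∞ E (fun x : M => TangentSpace 𝓘(ℝ, E) x)]
  [IsContMDiffRiemannianBundle 𝓘(ℝ, F) ∞ F (fun y : N => TangentSpace 𝓘(ℝ, F) y)]

theorem smoothAlongAt_sharp_component {q x : M} (hx : x ∈ (chartAt E q).source)
    (j : Fin (Module.finrank ℝ E)) :
    SmoothAlongAt E E (fun y => y) (sharp fun y => component q y j) x := by
  refine smoothAlongAt_sharp hx fun u => ?_
  refine (contMDiffAt_const (c := (Module.finBasis ℝ E).coord j u)).congr_of_eventuallyEq ?_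
  filter_upwards [eventually_mem_chart_source hx] with y hy
  exact congrArg (fun w : E => (Module.finBasis ℝ E).coord j w) (coord_frame hy u)

/-- The trace is rewritten with the frame of the chart at `x` and its metric dual, and tensoriality
replaces the extensions, which depend on `y`, by these fixed fields. -/
theorem smoothAlongAt_tension (hφ : ContMDiff 𝓘(ℝ, E) 𝓘(ℝ, F) ∞ φ) (x : M) :
    SmoothAlongAt E F φ (tension (E := E) φ) x := by
  have hx := mem_chart_source E x
  let b := Module.finBasis ℝ E
  have hev : ∀ (u : E), ∀ᶠ y in 𝓝 x, SmoothAlongAt E F φ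
      (fun y => mfderiv 𝓘(ℝ, E) 𝓘(ℝ, F) φ y (frame x u y)) y := fun u => by
    filter_upwards [eventually_mem_chart_source hx] with y hy
    exact smoothAlongAt_mfderiv_frame hφ hy u
  have hev' : ∀ (u : E), ∀ᶠ y in 𝓝 x, SmoothAlongAt E E (fun y => y) (frame x u) y := fun u => by
    filter_upwards [eventually_mem_chart_source hx] with y hy
    exact contMDiffAt_frame hy u
  have e : ∀ᶠ y in 𝓝 x, tension (E := E) φ y = ∑ j,
      (pullbackConn φ (fun y => mfderiv 𝓘(ℝ, E) 𝓘(ℝ, F) φ y (frame x (b j) y)) y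
          (sharp (fun y => component x y j) y)
        - mfderiv 𝓘(ℝ, E) 𝓘(ℝ, F) φ y
          (leviCivita (frame x (b j)) y (sharp (fun y => component x y j) y))) := by
    filter_upwards [eventually_mem_chart_source hx] with y hy
    have hA := fun u => smoothAlongAt_mfderiv_frame hφ (mem_chart_source E y) u
    refine (metricTrace_eq_sum hy (pullbackConnOneFormₗ hA)).trans ?_
    refine Finset.sum_congr rfl fun j _ => ?_
    exact pullbackConnOneForm_apply_section hA (contMDiffAt_frame hy (b j)) _
  refine SmoothAlongAt.congr (SmoothAlongAt.sum hφ.contMDiffAt fun j _ => ?_) e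
  have hS := smoothAlongAt_sharp_component hx j
  exact (SmoothAlongAt.pullbackConn (hev (b j)) hS).sub
    (SmoothAlongAt.mfderiv hφ.contMDiffAt (SmoothAlongAt.leviCivita (hev' (b j)) hS))

theorem inner_biharmonicCurrent (X : Π q : N, TangentSpace 𝓘(ℝ, F) q) (x : M)
    (v : TangentSpace 𝓘(ℝ, E) x) :
    inner ℝ (biharmonicCurrent φ X x) v =
      inner ℝ (tension (E := E) φ x) (pullbackConn φ (fun z => X (φ z)) x v)
        - inner ℝ (X (φ x)) (pullbackConn φ (tension (E := E) φ) x v) := by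
  rw [biharmonicCurrent, inner_sub_left, sharp, sharp, InnerProductSpace.toDual_symm_apply,
    InnerProductSpace.toDual_symm_apply]
  rfl

theorem smoothAlongAt_biharmonicCurrent {X : Π q : N, TangentSpace 𝓘(ℝ, F) q}
    (hX : ∀ q, SmoothAlongAt F F (fun q => q) X q) (hφ : ContMDiff 𝓘(ℝ, E) 𝓘(ℝ, F) ∞ φ) (x : M) :
    SmoothAlongAt E E (fun y => y) (fun y => biharmonicCurrent φ X y) x := by
  have hXφ : ∀ y, SmoothAlongAt E F φ (fun z => X (φ z)) y :=
    fun y => SmoothAlongAt.comp (hX (φ y)) hφ.contMDiffAt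
  rw [← sharp_inner fun y => biharmonicCurrent φ X y]
  refine smoothAlongAt_sharp (mem_chart_source E x) fun u => ?_
  have hu : SmoothAlongAt E E (fun y => y) (frame x u) x := contMDiffAt_frame (mem_chart_source E x) u
  have h1 := (smoothAlongAt_tension hφ x).inner
    (SmoothAlongAt.pullbackConn (Eventually.of_forall hXφ) hu)
  have h2 := (hXφ x).inner
    (SmoothAlongAt.pullbackConn (Eventually.of_forall (smoothAlongAt_tension hφ)) hu)
  exact (h1.sub h2).congr_of_eventuallyEq
    (Eventually.of_forall fun y => inner_biharmonicCurrent X y (frame x u y))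

/-- The product `⟨∇̄_u τ, ∇̄_u(X ∘ φ)⟩` arises from both halves of the current with opposite signs,
already before tracing. The derivative of the extension of `u` supplies the corrections that turn
iterated derivatives into second covariant ones. -/
theorem inner_leviCivita_biharmonicCurrent {X : Π q : N, TangentSpace 𝓘(ℝ, F) q}
    (hX : ∀ q, SmoothAlongAt F F (fun q => q) X q) (hφ : ContMDiff 𝓘(ℝ, E) 𝓘(ℝ, F) ∞ φ) (x : M)
    (u : TangentSpace 𝓘(ℝ, E) x) :
    inner ℝ (leviCivita (fun y => biharmonicCurrent φ X y) x u) u =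
      inner ℝ (tension (E := E) φ x)
          (pullbackConnOneForm φ (pullbackConn φ fun z => X (φ z)) x u u)
        - inner ℝ (X (φ x))
          (pullbackConnOneForm φ (pullbackConn φ (tension (E := E) φ)) x u u) := by
  have hXφ : ∀ y, SmoothAlongAt E F φ (fun z => X (φ z)) y :=
    fun y => SmoothAlongAt.comp (hX (φ y)) hφ.contMDiffAt
  have hτ := smoothAlongAt_tension (E := E) hφ
  have hu := (eventually_smoothAlongAt_extend u).self_of_nhds
  have h1 := SmoothAlongAt.pullbackConn (Eventually.of_forall hXφ) hu
  have h2 := SmoothAlongAt.pullbackConn (Eventually.of_forall hτ) hu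
  have h3 := mvfderiv_inner_leviCivita (smoothAlongAt_biharmonicCurrent hX hφ x) hu u
  have h4 := congrArg (fun T => T u) (mvfderiv_fun_sub
    (((hτ x).inner h1).mdifferentiableAt (by simp))
    (((hXφ x).inner h2).mdifferentiableAt (by simp)))
  rw [sub_apply, mvfderiv_inner (hτ x) h1, mvfderiv_inner (hXφ x) h2] at h4
  simp only [inner_biharmonicCurrent] at h3
  rw [h4] at h3
  simp only [FiberBundle.extend_apply_self] at h3
  rw [pullbackConnOneForm, pullbackConnOneForm, inner_sub_right, inner_sub_right]
  rw [real_inner_comm (pullbackConn φ (tension (E := E) φ) x u)] at h3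
  linarith

/-- The second covariant derivative of `X ∘ φ`. -/
theorem pullbackConnOneForm_pullbackConn_comp {X : Π q : N, TangentSpace 𝓘(ℝ, F) q}
    (hX : ∀ q, SmoothAlongAt F F (fun q => q) X q) (hφ : ContMDiff 𝓘(ℝ, E) 𝓘(ℝ, F) ∞ φ) (x : M)
    (u v : TangentSpace 𝓘(ℝ, E) x) :
    pullbackConnOneForm φ (pullbackConn φ fun z => X (φ z)) x u v =
      leviCivita X (φ x)
          (pullbackConnOneForm φ (fun y => mfderiv 𝓘(ℝ, E) 𝓘(ℝ, F) φ y) x u v)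
        + secondDeriv X (φ x) (mfderiv 𝓘(ℝ, E) 𝓘(ℝ, F) φ x u)
          (mfderiv 𝓘(ℝ, E) 𝓘(ℝ, F) φ x v) := by
  have hA : ∀ w : F, SmoothAlongAt F F (fun p => p)
      (fun p => leviCivita X p (frame (φ x) w p)) (φ x) := fun w =>
    SmoothAlongAt.leviCivita (Eventually.of_forall hX) (contMDiffAt_frame (mem_chart_source F _) w)
  have hv := (eventually_smoothAlongAt_extend v).self_of_nhds
  -- The product rule is applied to the endomorphism field `∇X` of `TN` and the field `dφ(V)` along
  -- `φ`, with `V` the extension of `v`.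
  have h := pullbackConn_clm_apply (φ := fun p : N => p) hA
    (SmoothAlongAt.mfderiv hφ.contMDiffAt hv) u
  have e : ∀ y w, pullbackConn φ (fun z => X (φ z)) y w =
      leviCivita X (φ y) (mfderiv 𝓘(ℝ, E) 𝓘(ℝ, F) φ y w) :=
    fun y w => pullbackConn_comp_section (hX (φ y)) hφ.contMDiffAt w
  rw [pullbackConnOneForm_leviCivita, FiberBundle.extend_apply_self] at h
  rw [pullbackConnOneForm, pullbackConnOneForm]
  simp only [e, map_sub]
  rw [h]
  abel

theorem divergence_biharmonicCurrent {X : Π q : N, TangentSpace 𝓘(ℝ, F) q} (hX : IsKilling X)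
    (hφ : ContMDiff 𝓘(ℝ, E) 𝓘(ℝ, F) ∞ φ) (x : M) :
    divergence (fun y : M => (biharmonicCurrent φ X y : TangentSpace 𝓘(ℝ, E) y)) x =
      - inner ℝ (X (φ x)) (bitension (E := E) φ x) := by
  let e := stdOrthonormalBasis ℝ (TangentSpace 𝓘(ℝ, E) x)
  have h1 : divergence (fun y : M => (biharmonicCurrent φ X y : TangentSpace 𝓘(ℝ, E) y)) x =
      ∑ i, inner ℝ (leviCivita (fun y => biharmonicCurrent φ X y) x (e i)) (e i) := by
    rw [divergence, LinearMap.trace_eq_sum_inner _ e]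
    exact Finset.sum_congr rfl fun i _ => real_inner_comm _ _
  have h2 : inner ℝ (leviCivita X (φ x) (tension (E := E) φ x)) (tension (E := E) φ x) = 0 := by
    have := hX.inner_leviCivita (φ x) (tension (E := E) φ x) (tension (E := E) φ x)
    linarith
  have h3 : leviCivita X (φ x) (tension (E := E) φ x) = ∑ i, leviCivita X (φ x)
      (pullbackConnOneForm φ (fun y => mfderiv 𝓘(ℝ, E) 𝓘(ℝ, F) φ y) x (e i) (e i)) := by
    rw [tension, metricTrace, map_sum]
  rw [h3, sum_inner] at h2
  -- The zero `⟨∇_τ X, τ⟩`, expanded by `h3` as a sum over the basis, is inserted so that the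
  -- identity can be checked summand by summand.
  rw [h1, bitension, roughLaplacian, neg_neg, inner_sub_right, metricTrace, metricTrace,
    inner_sum, inner_sum, neg_sub, ← zero_add (∑ i, inner ℝ (X (φ x)) (curvature _ _ _ _)), ← h2,
    ← Finset.sum_add_distrib, ← Finset.sum_sub_distrib]
  refine Finset.sum_congr rfl fun i _ => ?_
  rw [inner_leviCivita_biharmonicCurrent hX.smooth hφ,
    pullbackConnOneForm_pullbackConn_comp hX.smooth hφ, ← hX.inner_secondDeriv_self,
    ← inner_add_left, real_inner_comm (tension (E := E) φ x)]

end Current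

end BiharmonicCurrent

end

theorem mainTheorem3
    {E : Type*} [NormedAddCommGroup E] [NormedSpace ℝ E] [FiniteDimensional ℝ E]
    {M : Type*} [TopologicalSpace M] [T2Space M] [ChartedSpace E M] [IsManifold 𝓘(ℝ, E) ∞ M]
    [Bundle.RiemannianBundle (fun x : M => TangentSpace 𝓘(ℝ, E) x)]
    [IsContMDiffRiemannianBundle 𝓘(ℝ, E) ∞ E (fun x : M => TangentSpace 𝓘(ℝ, E) x)]
    {F : Type*} [NormedAddCommGroup F] [NormedSpace ℝ F] [FiniteDimensional ℝ F]
    {N : Type*} [TopologicalSpace N] [T2Space N] [ChartedSpace F N] [IsManifold 𝓘(ℝ, F) ∞ N]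
    [Bundle.RiemannianBundle (fun y : N => TangentSpace 𝓘(ℝ, F) y)]
    [IsContMDiffRiemannianBundle 𝓘(ℝ, F) ∞ F (fun y : N => TangentSpace 𝓘(ℝ, F) y)]
    (X : Π q : N, TangentSpace 𝓘(ℝ, F) q) (hX : BiharmonicCurrent.IsKilling X)
    (φ : M → N) (hφ : ContMDiff 𝓘(ℝ, E) 𝓘(ℝ, F) ∞ φ) :
    ContMDiff 𝓘(ℝ, E) 𝓘(ℝ, E).tangent ∞
        (fun x => (⟨x, BiharmonicCurrent.biharmonicCurrent φ X x⟩ : TangentBundle 𝓘(ℝ, E) M)) ∧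
      (∀ x : M,
        BiharmonicCurrent.divergence
            (fun y : M => (BiharmonicCurrent.biharmonicCurrent φ X y : TangentSpace 𝓘(ℝ, E) y)) x =
          - inner ℝ (X (φ x)) (BiharmonicCurrent.bitension (E := E) φ x)) ∧
      (BiharmonicCurrent.IsBiharmonic E F φ →
        ∀ x : M,
          BiharmonicCurrent.divergence
            (fun y : M => (BiharmonicCurrent.biharmonicCurrent φ X y : TangentSpace 𝓘(ℝ, E) y)) x =
          0) := by
  refine ⟨fun x => BiharmonicCurrent.smoothAlongAt_biharmonicCurrent hX.smooth hφ x,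
    BiharmonicCurrent.divergence_biharmonicCurrent hX hφ, fun h x => ?_⟩
  rw [BiharmonicCurrent.divergence_biharmonicCurrent hX hφ, h.bitension_eq_zero, inner_zero_right,
    neg_zero]
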